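/- Let $G$ be a complex linear algebraic group (a group variety biregularly isomorphic, as an algebraic group, to a Zariski closed subgroup of some $\mathrm{GL}_N(\mathbb{C})$), let $H\subseteq G$ be a Zariski closed subgroup, and let $\chi\colon G\to\mathbb{C}^\times$ be a nontrivial character (a homomorphism that is a regular map) with $\chi(H)=\{1\}$. Let $G/H$ be the quotient variety and let $\varphi\colon G/H\to\mathbb{C}^\times$, $\varphi(aH)=\chi(a)$. A map $f\colon K\to G/H$ on a compact set $K\subseteq\mathbb{C}^n$ is called holomorphic if it is the restriction of a holomorphic map defined on an open neighbourhood of $K$. It can be approximated on $K$ by regular maps $\mathbb{C}^n\to G/H$ if it lies in the closure, in the compact-open topology on the space of maps $K\to G/H$ that are continuous for the Euclidean topologies, of the set of restrictions to $K$ of regular maps $\mathbb{C}^n\to G/H$ (equivalently, it can be uniformly approximated by them with respect to a metric inducing the Euclidean topology of $G/H$). Then: 1. For every $n\ge 0$, every regular map $\mathbb{C}^n\to\mathbb{C}^\times$ is constant. 2. The map $\varphi$ is regular. 3. Let $K\subseteq\mathbb{C}^n$ be compact and (geometrically) convex and let $f\colon K\to G/H$ be a holomorphic map such that $\varphi\circ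 f$ is nonconstant. Then $f$ cannot be approximated on $K$ by regular maps $\mathbb{C}^n\to G/H$. 4. If $G$ is connected (in the Euclidean topology), then $\varphi$ is surjective. 5. Suppose that $\varphi$ is surjective (by 4, this holds if $G$ is connected). Then for every compact convex set $K\subseteq\mathbb{C}^n$ with at least two points there is a holomorphic map $f\colon K\to G/H$ that is null homotopic, for which $\varphi\circ f$ is nonconstant, and which cannot be approximated on $K$ by regular maps $\mathbb{C}^n\to G/H$. Moreover, $G/H$ is not algebraically subelliptic, i.e. there is no finite family of algebraic vector bundles $E_j\to G/H$ with regular maps $s_j\colon E_j\to G/H$ such that $s_j(0_y)=y$ and $\sum_j (ds_j)_{0_y}(E_{j,y})=T_y(G/H)$ for all $y\in G/H$. -/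

import Mathlib

open Topology

universe u v w

/-- A space with functions over `ℂ` (the classical language of varieties): a (Zariski) topology on
the set `X` together with a sheaf of `ℂ`-algebras of `ℂ`-valued functions. `IsRegularOn f U` says
that `U` is open and that the restriction of `f` to `U` is a section over `U`; the values of `f`
outside `U` are irrelevant. -/
structure SpaceWithFunctions (X : Type u) where
  zariski : TopologicalSpace X
  IsRegularOn : (X → ℂ) → Set X → Prop
  isOpen : ∀ {f : X → ℂ} {U : Set X}, IsRegularOn f U → IsOpen[zariski] U
  congr : ∀ {f g : X → ℂ} {U : Set X}, IsRegularOn f U → Set.EqOn f g U → IsRegularOn g U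
  mono : ∀ {f : X → ℂ} {U V : Set X},
    IsRegularOn f U → V ⊆ U → IsOpen[zariski] V → IsRegularOn f V
  glue : ∀ {f : X → ℂ} {U : Set X},
    (∀ x ∈ U, ∃ V : Set X, x ∈ V ∧ V ⊆ U ∧ IsRegularOn f V) → IsRegularOn f U
  const : ∀ (c : ℂ) {U : Set X}, IsOpen[zariski] U → IsRegularOn (fun _ => c) U
  add : ∀ {f g : X → ℂ} {U : Set X},
    IsRegularOn f U → IsRegularOn g U → IsRegularOn (fun x => f x + g x) U
  mul : ∀ {f g : X → ℂ} {U : Set X},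
    IsRegularOn f U → IsRegularOn g U → IsRegularOn (fun x => f x * g x) U

namespace SpaceWithFunctions

theorem isOpen_inter_aux {X : Type u} {t : TopologicalSpace X} {U V : Set X} (hU : IsOpen[t] U)
    (hV : IsOpen[t] V) : IsOpen[t] (U ∩ V) :=
  hU.inter hV

theorem isOpen_of_forall_aux {X : Type u} {t : TopologicalSpace X} {U : Set X}
    (h : ∀ x ∈ U, ∃ V ⊆ U, IsOpen[t] V ∧ x ∈ V) : IsOpen[t] U :=
  isOpen_iff_forall_mem_open.2 h

variable {X : Type u} {Y : Type v}

/-! ### Regular maps -/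

/-- `f` is a regular map (morphism) on the open subset `U` of `X`, with values in `Y`. -/
def IsRegularMapOn (S : SpaceWithFunctions X) (T : SpaceWithFunctions Y) (f : X → Y)
    (U : Set X) : Prop :=
  IsOpen[S.zariski] U ∧
    ∀ V : Set Y, IsOpen[T.zariski] V →
      IsOpen[S.zariski] (U ∩ f ⁻¹' V) ∧
        ∀ g : Y → ℂ, T.IsRegularOn g V → S.IsRegularOn (g ∘ f) (U ∩ f ⁻¹' V)

/-- Regular maps (morphisms of spaces with functions). -/
def IsRegularMap (S : SpaceWithFunctions X) (T : SpaceWithFunctions Y) (f : X → Y) : Prop :=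
  IsRegularMapOn S T f Set.univ

/-! ### The standard structures -/

/-- The structure induced on `X` by an injective coordinate map `c : X → ℂ^ι` whose image is a
locally closed subset of affine space: the topology is the induced Zariski topology, and the regular
functions are the ones that are locally quotients of polynomials in the coordinates. -/
def ofCoordinates {ι : Type w} (c : X → ι → ℂ) : SpaceWithFunctions X where
  zariski := TopologicalSpace.generateFrom
    {D | ∃ p : MvPolynomial ι ℂ, D = {x | MvPolynomial.eval (c x) p ≠ 0}}
  IsRegularOn f U := ∀ x ∈ U, ∃ V : Set X,
    IsOpen[TopologicalSpace.generateFrom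
      {D | ∃ p : MvPolynomial ι ℂ, D = {x | MvPolynomial.eval (c x) p ≠ 0}}] V ∧ x ∈ V ∧ V ⊆ U ∧
    ∃ p q : MvPolynomial ι ℂ, ∀ y ∈ V, MvPolynomial.eval (c y) q ≠ 0 ∧
      f y = MvPolynomial.eval (c y) p / MvPolynomial.eval (c y) q
  isOpen h := by
    refine isOpen_of_forall_aux fun x hx => ?_
    obtain ⟨V, hV, hxV, hVU, -⟩ := h x hx
    exact ⟨V, hVU, hV, hxV⟩
  congr h hfg x hx := by
    obtain ⟨V, hV, hxV, hVU, p, q, H⟩ := h x hx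
    exact ⟨V, hV, hxV, hVU, p, q, fun y hy => ⟨(H y hy).1, (hfg (hVU hy)) ▸ (H y hy).2⟩⟩
  mono h hWU hW x hx := by
    obtain ⟨V, hV, hxV, hVU, p, q, H⟩ := h x (hWU hx)
    exact ⟨V ∩ _, isOpen_inter_aux hV hW, ⟨hxV, hx⟩, Set.inter_subset_right, p, q,
      fun y hy => H y hy.1⟩
  glue h x hx := by
    obtain ⟨W, hxW, hWU, hW⟩ := h x hx
    obtain ⟨V, hV, hxV, hVW, H⟩ := hW x hxW
    exact ⟨V, hV, hxV, hVW.trans hWU, H⟩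
  const a U hU x hx := ⟨U, hU, hx, subset_rfl, MvPolynomial.C a, 1, fun y _ => by simp⟩
  add hf hg x hx := by
    obtain ⟨V, hV, hxV, hVU, p, q, H⟩ := hf x hx
    obtain ⟨V', hV', hxV', -, p', q', H'⟩ := hg x hx
    refine ⟨V ∩ V', isOpen_inter_aux hV hV', ⟨hxV, hxV'⟩,
      Set.inter_subset_left.trans hVU, p * q' + q * p', q * q', fun y hy => ?_⟩
    obtain ⟨h1, h2⟩ := H y hy.1
    obtain ⟨h3, h4⟩ := H' y hy.2
    refine ⟨by simp [h1, h3], ?_⟩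
    dsimp only
    rw [h2, h4, div_add_div _ _ h1 h3]
    simp
  mul hf hg x hx := by
    obtain ⟨V, hV, hxV, hVU, p, q, H⟩ := hf x hx
    obtain ⟨V', hV', hxV', -, p', q', H'⟩ := hg x hx
    refine ⟨V ∩ V', isOpen_inter_aux hV hV', ⟨hxV, hxV'⟩,
      Set.inter_subset_left.trans hVU, p * p', q * q', fun y hy => ?_⟩
    obtain ⟨h1, h2⟩ := H y hy.1
    obtain ⟨h3, h4⟩ := H' y hy.2
    refine ⟨by simp [h1, h3], ?_⟩
    dsimp only
    rw [h2, h4, div_mul_div_comm]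
    simp

/-- Affine space `ℂ^n` as an algebraic variety. -/
def affine (n : ℕ) : SpaceWithFunctions (Fin n → ℂ) :=
  ofCoordinates fun x => x

/-- The punctured line `ℂ^×` as an algebraic variety. -/
def punctured : SpaceWithFunctions ℂˣ :=
  ofCoordinates fun (z : ℂˣ) (_ : Unit) => (z : ℂ)

/-- The general linear group `GL_N(ℂ)` as an algebraic variety. -/
def generalLinear (N : ℕ) : SpaceWithFunctions (Matrix.GeneralLinearGroup (Fin N) ℂ) :=
  ofCoordinates fun g (ij : Fin N × Fin N) => (g : Matrix (Fin N) (Fin N) ℂ) ij.1 ij.2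

/-- A subgroup of `GL_N(ℂ)` with the structure induced by the matrix entries. -/
def matrixGroup {N : ℕ} (G : Subgroup (Matrix.GeneralLinearGroup (Fin N) ℂ)) :
    SpaceWithFunctions G :=
  ofCoordinates fun g (ij : Fin N × Fin N) =>
    ((g : Matrix.GeneralLinearGroup (Fin N) ℂ) : Matrix (Fin N) (Fin N) ℂ) ij.1 ij.2

/-- The quotient structure along `π : X → Q`: the quotient topology, and as regular functions those
whose pullback to `X` is regular. -/
def quotient (S : SpaceWithFunctions X) {Q : Type v} (π : X → Q) : SpaceWithFunctions Q where
  zariski := @TopologicalSpace.coinduced _ _ π S.zariski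
  IsRegularOn f U := S.IsRegularOn (f ∘ π) (π ⁻¹' U)
  isOpen h := S.isOpen h
  congr h hfg := S.congr h fun _ hx => hfg hx
  mono h hVU hV := S.mono h (Set.preimage_mono hVU) hV
  glue h := S.glue fun x hx => by
    obtain ⟨V, hV, hVU, hf⟩ := h (π x) hx
    exact ⟨π ⁻¹' V, hV, Set.preimage_mono hVU, hf⟩
  const a _ hU := S.const a hU
  add hf hg := S.add hf hg
  mul hf hg := S.mul hf hg

/-- The algebra of functions on `X × Y` that is generated by the regular functions on `U ⊆ X` and
the regular functions on `V ⊆ Y`; on `U × V` its members are the finite sums `∑ aᵢ(x) bᵢ(y)` with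
`aᵢ` regular on `U` and `bᵢ` regular on `V`. -/
def tensorFunctions (S : SpaceWithFunctions X) (T : SpaceWithFunctions Y) (U : Set X) (V : Set Y) :
    Subalgebra ℂ (X × Y → ℂ) :=
  Algebra.adjoin ℂ
    ({h | ∃ a : X → ℂ, S.IsRegularOn a U ∧ h = fun z => a z.1} ∪
      {h | ∃ b : Y → ℂ, T.IsRegularOn b V ∧ h = fun z => b z.2})

theorem tensorFunctions_mono (S : SpaceWithFunctions X) (T : SpaceWithFunctions Y)
    {U U' : Set X} {V V' : Set Y} (hU : U' ⊆ U) (hV : V' ⊆ V) (oU : IsOpen[S.zariski] U')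
    (oV : IsOpen[T.zariski] V') : S.tensorFunctions T U V ≤ S.tensorFunctions T U' V' := by
  refine Algebra.adjoin_mono (Set.union_subset_union ?_ ?_)
  · rintro _ ⟨a, ha, rfl⟩
    exact ⟨a, S.mono ha hU oU, rfl⟩
  · rintro _ ⟨b, hb, rfl⟩
    exact ⟨b, T.mono hb hV oV, rfl⟩

/-- The Zariski topology of the product `X × Y`, generated by the sets
`{z ∈ U × V | h z ≠ 0}` with `h = ∑ aᵢ(x) bᵢ(y)` as above. -/
@[reducible] def prodZariski (S : SpaceWithFunctions X) (T : SpaceWithFunctions Y) :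
    TopologicalSpace (X × Y) :=
  TopologicalSpace.generateFrom
    {D | ∃ U V h, IsOpen[S.zariski] U ∧ IsOpen[T.zariski] V ∧ h ∈ S.tensorFunctions T U V ∧
      D = {z | z ∈ U ×ˢ V ∧ h z ≠ 0}}

/-- The product of two varieties: regular functions are locally quotients of functions of the form
`∑ aᵢ(x) bᵢ(y)`. -/
def prod (S : SpaceWithFunctions X) (T : SpaceWithFunctions Y) : SpaceWithFunctions (X × Y) where
  zariski := S.prodZariski T
  IsRegularOn f W := ∀ z ∈ W, ∃ O : Set (X × Y), IsOpen[S.prodZariski T] O ∧ z ∈ O ∧ O ⊆ W ∧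
    ∃ U V, IsOpen[S.zariski] U ∧ IsOpen[T.zariski] V ∧ O ⊆ U ×ˢ V ∧
      ∃ p ∈ S.tensorFunctions T U V, ∃ q ∈ S.tensorFunctions T U V,
        ∀ y ∈ O, q y ≠ 0 ∧ f y = p y / q y
  isOpen h := by
    refine isOpen_of_forall_aux fun x hx => ?_
    obtain ⟨V, hV, hxV, hVU, -⟩ := h x hx
    exact ⟨V, hVU, hV, hxV⟩
  congr h hfg x hx := by
    obtain ⟨O, hO, hxO, hOW, U, V, hU, hV, hOUV, p, hp, q, hq, H⟩ := h x hx
    exact ⟨O, hO, hxO, hOW, U, V, hU, hV, hOUV, p, hp, q, hq,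
      fun y hy => ⟨(H y hy).1, (hfg (hOW hy)) ▸ (H y hy).2⟩⟩
  mono h hW' hoW' x hx := by
    obtain ⟨O, hO, hxO, hOW, U, V, hU, hV, hOUV, p, hp, q, hq, H⟩ := h x (hW' hx)
    exact ⟨O ∩ _, isOpen_inter_aux hO hoW', ⟨hxO, hx⟩, Set.inter_subset_right, U, V, hU, hV,
      Set.inter_subset_left.trans hOUV, p, hp, q, hq, fun y hy => H y hy.1⟩
  glue h x hx := by
    obtain ⟨W, hxW, hWU, hW⟩ := h x hx
    obtain ⟨O, hO, hxO, hOW, H⟩ := hW x hxW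
    exact ⟨O, hO, hxO, hOW.trans hWU, H⟩
  const a W hW x hx := ⟨W, hW, hx, subset_rfl, Set.univ, Set.univ, @isOpen_univ _ (_),
    @isOpen_univ _ (_), by simp, algebraMap ℂ _ a, Subalgebra.algebraMap_mem _ a, 1,
    Subalgebra.one_mem _, fun y _ => by simp⟩
  add hf hg x hx := by
    obtain ⟨O, hO, hxO, hOW, U, V, hU, hV, hOUV, p, hp, q, hq, H⟩ := hf x hx
    obtain ⟨O', hO', hxO', -, U', V', hU', hV', hOUV', p', hp', q', hq', H'⟩ := hg x hx
    have oU := isOpen_inter_aux hU hU'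
    have oV := isOpen_inter_aux hV hV'
    have m := S.tensorFunctions_mono T (U := U) (V := V) Set.inter_subset_left
      Set.inter_subset_left oU oV
    have m' := S.tensorFunctions_mono T (U := U') (V := V') Set.inter_subset_right
      Set.inter_subset_right oU oV
    refine ⟨O ∩ O', isOpen_inter_aux hO hO', ⟨hxO, hxO'⟩,
      Set.inter_subset_left.trans hOW, U ∩ U', V ∩ V', oU, oV, ?_, p * q' + q * p',
      add_mem (mul_mem (m hp) (m' hq')) (mul_mem (m hq) (m' hp')), q * q',
      mul_mem (m hq) (m' hq'), fun y hy => ?_⟩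
    · rw [← Set.prod_inter_prod]
      exact Set.inter_subset_inter hOUV hOUV'
    · obtain ⟨h1, h2⟩ := H y hy.1
      obtain ⟨h3, h4⟩ := H' y hy.2
      refine ⟨by simp [h1, h3], ?_⟩
      dsimp only
      rw [h2, h4, div_add_div _ _ h1 h3]
      simp
  mul hf hg x hx := by
    obtain ⟨O, hO, hxO, hOW, U, V, hU, hV, hOUV, p, hp, q, hq, H⟩ := hf x hx
    obtain ⟨O', hO', hxO', -, U', V', hU', hV', hOUV', p', hp', q', hq', H'⟩ := hg x hx
    have oU := isOpen_inter_aux hU hU'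
    have oV := isOpen_inter_aux hV hV'
    have m := S.tensorFunctions_mono T (U := U) (V := V) Set.inter_subset_left
      Set.inter_subset_left oU oV
    have m' := S.tensorFunctions_mono T (U := U') (V := V') Set.inter_subset_right
      Set.inter_subset_right oU oV
    refine ⟨O ∩ O', isOpen_inter_aux hO hO', ⟨hxO, hxO'⟩,
      Set.inter_subset_left.trans hOW, U ∩ U', V ∩ V', oU, oV, ?_, p * p',
      mul_mem (m hp) (m' hp'), q * q',
      mul_mem (m hq) (m' hq'), fun y hy => ?_⟩
    · rw [← Set.prod_inter_prod]
      exact Set.inter_subset_inter hOUV hOUV'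
    · obtain ⟨h1, h2⟩ := H y hy.1
      obtain ⟨h3, h4⟩ := H' y hy.2
      refine ⟨by simp [h1, h3], ?_⟩
      dsimp only
      rw [h2, h4, div_mul_div_comm]
      simp

/-! ### The Euclidean topology, holomorphic maps, approximation -/

/-- The set `X` with the Euclidean topology of the variety. -/
def Analytic (_ : SpaceWithFunctions X) : Type u := X

/-- The Euclidean topology: the coarsest one in which Zariski open sets are open and regular
functions on them are continuous. -/
instance (S : SpaceWithFunctions X) : TopologicalSpace S.Analytic :=
  TopologicalSpace.generateFrom
    {W : Set X | ∃ (f : X → ℂ) (U : Set X) (B : Set ℂ),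
      S.IsRegularOn f U ∧ IsOpen B ∧ W = U ∩ f ⁻¹' B}

/-- `F` is a holomorphic map on the open set `Ω ⊆ ℂ^n` with values in the complex space underlying
`Y`: it is continuous, and `g ∘ F` is holomorphic for every local regular function `g` on `Y` (in
particular for the coordinates of a local embedding of `Y` into an affine space). -/
def IsHolomorphicMapOn {n : ℕ} (T : SpaceWithFunctions Y) (F : (Fin n → ℂ) → T.Analytic)
    (Ω : Set (Fin n → ℂ)) : Prop :=
  IsOpen Ω ∧ ContinuousOn F Ω ∧
    ∀ (g : Y → ℂ) (V : Set Y), T.IsRegularOn g V →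
      DifferentiableOn ℂ (fun x => g (F x)) (Ω ∩ {x | F x ∈ V})

/-- A map `f : K → Y` on `K ⊆ ℂ^n` is holomorphic if it is the restriction of a holomorphic map on
an open neighbourhood of `K`. -/
def IsHolomorphic {n : ℕ} {K : Set (Fin n → ℂ)} (T : SpaceWithFunctions Y)
    (f : C(K, T.Analytic)) : Prop :=
  ∃ (Ω : Set (Fin n → ℂ)) (F : (Fin n → ℂ) → T.Analytic),
    K ⊆ Ω ∧ T.IsHolomorphicMapOn F Ω ∧ ∀ x : K, F x = f x

/-- `f : K → Y` can be approximated on `K` by (restrictions of) regular maps `ℂ^n → Y`, in the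
compact-open topology of the space of continuous maps. For compact `K` this is uniform approximation
with respect to any metric on `Y` that induces the Euclidean topology. -/
def ApproximableByRegularMaps {n : ℕ} {K : Set (Fin n → ℂ)} (T : SpaceWithFunctions Y)
    (f : C(K, T.Analytic)) : Prop :=
  f ∈ closure {g : C(K, T.Analytic) |
    ∃ p : (Fin n → ℂ) → Y, IsRegularMap (affine n) T p ∧ ∀ x : K, g x = p x}

/-! ### Tangent spaces -/

/-- The local ring of `X` at `x`, consisting of the germs at `x` of regular functions, as a vector
space over `ℂ`. -/
def stalk (S : SpaceWithFunctions X) (x : X) :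
    Submodule ℂ (Filter.Germ (@nhds X S.zariski x) ℂ) where
  carrier := {φ | ∃ (f : X → ℂ) (U : Set X), x ∈ U ∧ S.IsRegularOn f U ∧ φ = (f : Filter.Germ _ ℂ)}
  zero_mem' := ⟨fun _ => 0, Set.univ, Set.mem_univ _, S.const 0 (@isOpen_univ _ (_)), rfl⟩
  add_mem' := by
    rintro _ _ ⟨f, U, hU, hf, rfl⟩ ⟨g, V, hV, hg, rfl⟩
    have o := isOpen_inter_aux (S.isOpen hf) (S.isOpen hg)
    exact ⟨_, U ∩ V, ⟨hU, hV⟩, S.add (S.mono hf Set.inter_subset_left o)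
      (S.mono hg Set.inter_subset_right o), rfl⟩
  smul_mem' := by
    rintro c _ ⟨f, U, hU, hf, rfl⟩
    exact ⟨_, U, hU, S.mul (S.const c (S.isOpen hf)) hf, rfl⟩

/-- The germ at `x` of a function that is regular on an open set `U` containing `x`. -/
def germ (S : SpaceWithFunctions X) {x : X} {f : X → ℂ} {U : Set X} (hx : x ∈ U)
    (hf : S.IsRegularOn f U) : S.stalk x :=
  ⟨(f : Filter.Germ _ ℂ), f, U, hx, hf, rfl⟩

/-- The (Zariski) tangent space of `X` at `x`: the `ℂ`-linear derivations of the local ring at `x`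
with values in `ℂ`, `D (f g) = f(x) D g + g(x) D f`. -/
def tangentSpace (S : SpaceWithFunctions X) (x : X) : Submodule ℂ (Module.Dual ℂ (S.stalk x)) where
  carrier := {D | ∀ (f g : X → ℂ) (U : Set X) (hx : x ∈ U) (hf : S.IsRegularOn f U)
    (hg : S.IsRegularOn g U),
    D (S.germ hx (S.mul hf hg)) = f x * D (S.germ hx hg) + g x * D (S.germ hx hf)}
  zero_mem' := by intro f g U hx hf hg; simp
  add_mem' := by
    intro D D' h h' f g U hx hf hg
    simp only [LinearMap.add_apply, h f g U hx hf hg, h' f g U hx hf hg]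
    ring
  smul_mem' := by
    intro c D h f g U hx hf hg
    simp only [LinearMap.smul_apply, h f g U hx hf hg, smul_eq_mul]
    ring

/-! ### Algebraic vector bundles and sprays -/

/-- An algebraic vector bundle on `Y`: a variety `E` with a regular projection to `Y` whose fibres
are vector spaces, locally trivial in the Zariski topology. The local trivialization over `U` and
its inverse are `(y, v) ↦ (y, e y v)` and `(y, z) ↦ (y, e' y z)`; the values of `e` and `e'` at
points outside `U` are irrelevant. -/
structure AlgebraicVectorBundle (S : SpaceWithFunctions Y) where
  fiber : Y → Type
  [addCommGroup : ∀ y, AddCommGroup (fiber y)]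
  [module : ∀ y, Module ℂ (fiber y)]
  total : SpaceWithFunctions (Σ y, fiber y)
  isRegularMap_proj : IsRegularMap total S Sigma.fst
  locallyTrivial : ∀ y : Y, ∃ U : Set Y, IsOpen[S.zariski] U ∧ y ∈ U ∧
    ∃ (k : ℕ) (e : ∀ u, fiber u →ₗ[ℂ] (Fin k → ℂ)) (e' : ∀ u, (Fin k → ℂ) →ₗ[ℂ] fiber u),
      (∀ u ∈ U, e' u ∘ₗ e u = LinearMap.id ∧ e u ∘ₗ e' u = LinearMap.id) ∧
      IsRegularMapOn total (S.prod (affine k)) (fun v => (v.1, e v.1 v.2)) (Sigma.fst ⁻¹' U) ∧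
      IsRegularMapOn (S.prod (affine k)) total (fun z => ⟨z.1, e' z.1 z.2⟩) (U ×ˢ Set.univ)

attribute [instance] AlgebraicVectorBundle.addCommGroup AlgebraicVectorBundle.module

/-- An algebraic spray on `Y`: an algebraic vector bundle `E` on `Y` and a regular map `s : E → Y`
with `s (0_y) = y` for all `y`. -/
structure AlgebraicSpray (S : SpaceWithFunctions Y) extends AlgebraicVectorBundle S where
  map : (Σ y, fiber y) → Y
  isRegularMap_map : IsRegularMap total S map
  map_zero : ∀ y, map ⟨y, 0⟩ = y

/-- The subset `(ds)_{0_y}(E_y)` of `T_y Y`: the image of `E_y`, regarded as the vertical tangent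
space of `E` at `0_y`, under the differential of `s`. The image of `v` is the derivation
`g ↦ d/dt g(s(t v))` at `t = 0`. -/
def AlgebraicSpray.verticalImage {S : SpaceWithFunctions Y} (s : AlgebraicSpray S) (y : Y) :
    Set (S.tangentSpace y) :=
  {D | ∃ v : s.fiber y, ∀ (g : Y → ℂ) (U : Set Y) (hy : y ∈ U) (hg : S.IsRegularOn g U),
    HasDerivAt (fun t : ℂ => g (s.map ⟨y, t • v⟩)) (D.1 (S.germ hy hg)) 0}

/-- `Y` is algebraically subelliptic if it admits finitely many algebraic sprays `(E_j, s_j)` such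
that `∑_j (ds_j)_{0_y}(E_{j,y}) = T_y Y` for every `y`. -/
def IsAlgebraicallySubelliptic (S : SpaceWithFunctions Y) : Prop :=
  ∃ (m : ℕ) (s : Fin m → AlgebraicSpray S),
    ∀ y : Y, Submodule.span ℂ (⋃ j, (s j).verticalImage y) = ⊤

/-! ### Linear algebraic groups, characters and homogeneous spaces -/

/-- A group that is a variety is a linear algebraic group if it is biregularly isomorphic to a
Zariski closed subgroup of some `GL_N(ℂ)`. -/
def IsLinearAlgebraicGroup {G : Type u} [Group G] (S : SpaceWithFunctions G) : Prop :=
  ∃ (N : ℕ) (G' : Subgroup (Matrix.GeneralLinearGroup (Fin N) ℂ)),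
    IsClosed[(generalLinear N).zariski] (G' : Set (Matrix.GeneralLinearGroup (Fin N) ℂ)) ∧
    ∃ e : G ≃* G', IsRegularMap S (matrixGroup G') e ∧ IsRegularMap (matrixGroup G') S e.symm

/-- The quotient variety `G/H`. -/
def homogeneous {G : Type u} [Group G] (S : SpaceWithFunctions G) (H : Subgroup G) :
    SpaceWithFunctions (G ⧸ H) :=
  S.quotient (fun a : G => (a : G ⧸ H))

end SpaceWithFunctions

/-- The map `φ : G/H → ℂ^×`, `φ(aH) = χ(a)`, for a homomorphism `χ` that is trivial on `H`. -/
def characterDescent {G : Type u} [Group G] (H : Subgroup G) (χ : G →* ℂˣ)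
    (hχH : ∀ h ∈ H, χ h = 1) : G ⧸ H → ℂˣ :=
  Quotient.lift χ fun a b hab => by
    have h := hχH _ (QuotientGroup.leftRel_apply.1 hab)
    rw [map_mul, map_inv, inv_mul_eq_one] at h
    exact h

namespace SpaceWithFunctions

variable {X : Type u} {Y : Type v} {Z : Type w}

/-! ### Regular maps -/

/-! Units of a polynomial ring over `ℂ` are constants, so a regular map `ℂ^n → ℂ^×` is constant
(`IsRegularMap.exists_eq_const`, by restriction to lines). Hence `φ ∘ p` is constant for every
regular `p : ℂ^n → G/H`. For two points `x`, `y` of `K`, the condition `φ (g x) = φ (g y)` is closed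
in the compact-open topology, so it survives in the limit: this is the whole obstruction
(`not_approximableByRegularMaps`). Regularity of `φ` is the universal property of the quotient.

All existence statements come from a holomorphic curve `γ` in `G` with `χ (γ t) = t` near some `T₀`
(`IsLinearAlgebraicGroup.exists_section`). It is built from algebra alone, without Lie theory. If
`χ` has infinitely many values, a piece of `G` on which `χ` is a quotient of polynomials is an
affine variety. An ultrapower argument and Zariski's lemma give it a point over a finite extension
of `ℂ(T)` at which `χ` equals `T`. A primitive element turns this point into a plane curve over the
`T`-line, and the implicit function theorem gives a local branch of the curve
(`exists_holomorphic_section`).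

If `G` is connected, the image of `χ` is connected with more than one point, hence infinite; values
of `χ` near `1` are then supplied by `γ`, and their powers fill `ℂ^×`. Composing `γ` with a small
affine function on a convex `K` yields the maps that cannot be approximated. Finally, the fibres of
a spray are affine spaces, so `φ` is constant along them (`AlgebraicSpray.comp_map_eq`) and `dφ`
kills their images, whereas `dφ` is nonzero on the tangent vector of `γ`. -/

theorem IsRegularMapOn.comp {S : SpaceWithFunctions X} {T : SpaceWithFunctions Y}
    {W : SpaceWithFunctions Z} {f : X → Y} {g : Y → Z} {U : Set X} {U' : Set Y}
    (hg : IsRegularMapOn T W g U') (hf : IsRegularMapOn S T f U) (hU : Set.MapsTo f U U') :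
    IsRegularMapOn S W (g ∘ f) U := by
  refine ⟨hf.1, fun V hV => ?_⟩
  have e : U ∩ g ∘ f ⁻¹' V = U ∩ f ⁻¹' (U' ∩ g ⁻¹' V) := by
    ext x
    exact ⟨fun h => ⟨h.1, hU h.1, h.2⟩, fun h => ⟨h.1, h.2.2⟩⟩
  obtain ⟨h1, h2⟩ := hg.2 V hV
  obtain ⟨h3, h4⟩ := hf.2 _ h1
  rw [e]
  exact ⟨h3, fun k hk => h4 _ (h2 k hk)⟩

theorem IsRegularMap.comp {S : SpaceWithFunctions X} {T : SpaceWithFunctions Y}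
    {W : SpaceWithFunctions Z} {f : X → Y} {g : Y → Z}
    (hg : IsRegularMap T W g) (hf : IsRegularMap S T f) : IsRegularMap S W (g ∘ f) :=
  IsRegularMapOn.comp hg hf (Set.mapsTo_univ _ _)

theorem IsRegularMap.isOpen_preimage {S : SpaceWithFunctions X} {T : SpaceWithFunctions Y}
    {f : X → Y} (hf : IsRegularMap S T f) {V : Set Y} (hV : IsOpen[T.zariski] V) :
    IsOpen[S.zariski] (f ⁻¹' V) := by
  simpa using (hf.2 V hV).1

theorem IsRegularMap.isRegularOn_comp {S : SpaceWithFunctions X} {T : SpaceWithFunctions Y}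
    {f : X → Y} (hf : IsRegularMap S T f) {V : Set Y} {g : Y → ℂ} (hg : T.IsRegularOn g V) :
    S.IsRegularOn (g ∘ f) (f ⁻¹' V) := by
  simpa using (hf.2 V (T.isOpen hg)).2 g hg

theorem isRegularMap_of {S : SpaceWithFunctions X} {T : SpaceWithFunctions Y} {f : X → Y}
    (h : ∀ V, IsOpen[T.zariski] V → IsOpen[S.zariski] (f ⁻¹' V))
    (h' : ∀ V g, T.IsRegularOn g V → S.IsRegularOn (g ∘ f) (f ⁻¹' V)) : IsRegularMap S T f :=
  ⟨@isOpen_univ _ (_), fun V hV => by simpa using ⟨h V hV, h' V⟩⟩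

theorem isRegularMap_quotient (S : SpaceWithFunctions X) (π : X → Y) :
    IsRegularMap S (S.quotient π) π :=
  isRegularMap_of (fun _ hV => hV) fun _ _ hg => hg

/-- The universal property of the quotient structure. -/
theorem isRegularMap_of_comp_quotient {S : SpaceWithFunctions X} {T : SpaceWithFunctions Z}
    {π : X → Y} {f : Y → Z} (hf : IsRegularMap S T (f ∘ π)) : IsRegularMap (S.quotient π) T f :=
  isRegularMap_of (fun _ hV => hf.isOpen_preimage hV) fun _ _ hg => hf.isRegularOn_comp hg

/-! ### Structures induced by coordinates -/

section Coordinates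

variable {ι : Type*}

theorem isOpen_eval_ne_zero (c : X → ι → ℂ) (p : MvPolynomial ι ℂ) :
    IsOpen[(ofCoordinates c).zariski] {x | MvPolynomial.eval (c x) p ≠ 0} :=
  TopologicalSpace.isOpen_generateFrom_of_mem ⟨p, rfl⟩

/-- The nonvanishing sets of polynomials are a basis of the Zariski topology. -/
theorem exists_eval_ne_zero_subset {c : X → ι → ℂ} {V : Set X}
    (hV : IsOpen[(ofCoordinates c).zariski] V) {x : X} (hx : x ∈ V) :
    ∃ h : MvPolynomial ι ℂ, MvPolynomial.eval (c x) h ≠ 0 ∧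
      ∀ y, MvPolynomial.eval (c y) h ≠ 0 → y ∈ V := by
  induction hV with
  | basic s hs =>
    obtain ⟨p, rfl⟩ := hs
    exact ⟨p, hx, fun y hy => hy⟩
  | univ => exact ⟨1, by simp, fun _ _ => trivial⟩
  | inter s t _ _ hs ht =>
    obtain ⟨p, hp, hp'⟩ := hs hx.1
    obtain ⟨q, hq, hq'⟩ := ht hx.2
    refine ⟨p * q, by simp [hp, hq], fun y hy => ?_⟩
    rw [map_mul, mul_ne_zero_iff] at hy
    exact ⟨hp' y hy.1, hq' y hy.2⟩
  | sUnion s _ hs =>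
    obtain ⟨t, ht, hxt⟩ := hx
    obtain ⟨p, hp, hp'⟩ := hs t ht hxt
    exact ⟨p, hp, fun y hy => ⟨t, ht, hp' y hy⟩⟩

/-- Shrinking each neighbourhood to a basic open set `h ≠ 0` turns regularity into a statement about
three polynomials, which can be restricted to lines or used as equations of a variety. -/
theorem isRegularOn_ofCoordinates_iff {c : X → ι → ℂ} {f : X → ℂ} {U : Set X} :
    (ofCoordinates c).IsRegularOn f U ↔ ∀ x ∈ U, ∃ h p q : MvPolynomial ι ℂ,
      MvPolynomial.eval (c x) h ≠ 0 ∧ ∀ y, MvPolynomial.eval (c y) h ≠ 0 →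
        y ∈ U ∧ MvPolynomial.eval (c y) q ≠ 0 ∧
          f y = MvPolynomial.eval (c y) p / MvPolynomial.eval (c y) q := by
  constructor
  · intro hf x hx
    obtain ⟨V, hV, hxV, hVU, p, q, H⟩ := hf x hx
    obtain ⟨h, hh, hV⟩ := exists_eval_ne_zero_subset (c := c) hV hxV
    exact ⟨h, p, q, hh, fun y hy => ⟨hVU (hV y hy), H y (hV y hy)⟩⟩
  · intro H x hx
    obtain ⟨h, p, q, hh, H⟩ := H x hx
    exact ⟨_, isOpen_eval_ne_zero c h, hh, fun y hy => (H y hy).1, p, q, fun y hy => (H y hy).2⟩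

theorem isRegularOn_eval (c : X → ι → ℂ) (p : MvPolynomial ι ℂ) :
    (ofCoordinates c).IsRegularOn (fun x => MvPolynomial.eval (c x) p) Set.univ :=
  isRegularOn_ofCoordinates_iff.2 fun x _ =>
    ⟨1, p, 1, by simp, fun y _ => ⟨trivial, by simp, by simp⟩⟩

theorem isOpen_of_isRegularOn_ne_zero {c : X → ι → ℂ} {f : X → ℂ} {U : Set X}
    (hf : (ofCoordinates c).IsRegularOn f U) :
    IsOpen[(ofCoordinates c).zariski] {x | x ∈ U ∧ f x ≠ 0} := by
  refine isOpen_of_forall_aux fun x hx => ?_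
  obtain ⟨h, p, q, hh, H⟩ := isRegularOn_ofCoordinates_iff.1 hf x hx.1
  refine ⟨_, fun y hy => ?_, isOpen_eval_ne_zero c (h * p), ?_⟩
  · simp only [map_mul, mul_ne_zero_iff, Set.mem_ofPred_eq] at hy
    obtain ⟨h1, h2, h3⟩ := H y hy.1
    exact ⟨h1, h3 ▸ div_ne_zero hy.2 h2⟩
  · obtain ⟨h1, h2, h3⟩ := H x hh
    simp only [map_mul, mul_ne_zero_iff, Set.mem_ofPred_eq]
    refine ⟨hh, fun h0 => hx.2 ?_⟩
    rw [h3, h0, zero_div]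

theorem isRegularOn_ofCoordinates_div {c : X → ι → ℂ} {f g : X → ℂ} {U V : Set X}
    (hf : (ofCoordinates c).IsRegularOn f U) (hg : (ofCoordinates c).IsRegularOn g U)
    (hVU : V ⊆ U) (hV : IsOpen[(ofCoordinates c).zariski] V) (h0 : ∀ x ∈ V, g x ≠ 0) :
    (ofCoordinates c).IsRegularOn (fun x => f x / g x) V := by
  refine isRegularOn_ofCoordinates_iff.2 fun x hx => ?_
  obtain ⟨h, p, q, hh, H⟩ := isRegularOn_ofCoordinates_iff.1 hf x (hVU hx)
  obtain ⟨h', p', q', hh', H'⟩ := isRegularOn_ofCoordinates_iff.1 hg x (hVU hx)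
  obtain ⟨k, hk, hkV⟩ := exists_eval_ne_zero_subset hV hx
  refine ⟨h * h' * k, p * q', q * p', by simp [hh, hh', hk], fun y hy => ?_⟩
  simp only [map_mul, mul_ne_zero_iff] at hy
  obtain ⟨-, h1, h2⟩ := H y hy.1.1
  obtain ⟨-, h3, h4⟩ := H' y hy.1.2
  have h5 := h0 y (hkV y hy.2)
  have h6 : MvPolynomial.eval (c y) p' ≠ 0 := by
    rintro h6
    rw [h4, h6, zero_div] at h5
    exact h5 rfl
  refine ⟨hkV y hy.2, by simp [h1, h6], ?_⟩
  simp only [h2, h4, map_mul]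
  field_simp

end Coordinates

theorem isRegularOn_val_punctured : punctured.IsRegularOn (fun z => (z : ℂ)) Set.univ := by
  have h := isRegularOn_eval (fun (z : ℂˣ) (_ : Unit) => (z : ℂ)) (MvPolynomial.X ())
  simp only [MvPolynomial.eval_X] at h
  exact h

theorem IsRegularMap.isRegularOn_val {S : SpaceWithFunctions X} {χ : X → ℂˣ}
    (h : IsRegularMap S punctured χ) : S.IsRegularOn (fun x => (χ x : ℂ)) Set.univ :=
  h.isRegularOn_comp isRegularOn_val_punctured

/-! ### Regular maps from affine space to the punctured line -/

theorem eval_line {n : ℕ} (a b : Fin n → ℂ) (p : MvPolynomial (Fin n) ℂ) (t : ℂ) :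
    Polynomial.eval t (MvPolynomial.aeval
      (fun i => Polynomial.C (a i) + Polynomial.C (b i) * Polynomial.X) p) =
      MvPolynomial.eval (fun i => a i + b i * t) p := by
  induction p using MvPolynomial.induction_on with
  | C r => simp
  | add p q hp hq => simp [hp, hq]
  | mul_X p i hp => simp [hp]

/-- A function without zeros on the line that is locally a quotient of polynomials (in the
Zariski topology) is constant. -/
theorem exists_eq_const_of_locally_quotient (f : ℂ → ℂ) (h0 : ∀ t, f t ≠ 0)
    (hf : ∀ t, ∃ h p q : Polynomial ℂ, h.eval t ≠ 0 ∧
      ∀ s, h.eval s ≠ 0 → q.eval s ≠ 0 ∧ f s = p.eval s / q.eval s) : ∃ c, ∀ t, f t = c := by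
  obtain ⟨h, p, q, hh, H⟩ := hf 0
  have hne : ∀ {h : Polynomial ℂ} {t : ℂ}, h.eval t ≠ 0 → h ≠ 0 := by
    rintro h t ht rfl
    simp at ht
  have hq0 : q ≠ 0 := hne (H 0 hh).1
  -- Write the quotient near `0` in lowest terms; this one fraction will represent `f` everywhere.
  obtain ⟨p', q', hpq, g, hp, hq⟩ : ∃ p' q' : Polynomial ℂ, IsCoprime p' q' ∧
      ∃ g, p = g * p' ∧ q = g * q' := by
    have hg : EuclideanDomain.gcd p q ≠ 0 := fun h => hq0 (EuclideanDomain.gcd_eq_zero_iff.1 h).2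
    obtain ⟨p', h1⟩ := EuclideanDomain.gcd_dvd_left p q
    obtain ⟨q', h2⟩ := EuclideanDomain.gcd_dvd_right p q
    refine ⟨p', q', ⟨EuclideanDomain.gcdA p q, EuclideanDomain.gcdB p q, ?_⟩, _, h1, h2⟩
    have h3 := EuclideanDomain.gcd_eq_gcd_ab p q
    refine mul_left_cancel₀ hg ?_
    linear_combination -h3 - EuclideanDomain.gcdA p q * h1 - EuclideanDomain.gcdB p q * h2
  have hg0 : g ≠ 0 := by
    rintro rfl
    simp [hq] at hq0
  have key : ∀ t, f t * q'.eval t = p'.eval t := by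
    intro t
    obtain ⟨k, r, s, hk, K⟩ := hf t
    have e : r * q' = s * p' := by
      -- The two local fractions agree where `h` and `k` are nonzero; the factor `h * k * g` makes
      -- the identity hold at every point, and it is cancelled afterwards.
      have : h * k * g * (r * q' - s * p') = 0 := by
        refine Polynomial.funext fun x => ?_
        by_cases hx : h.eval x = 0
        · simp [hx]
        by_cases kx : k.eval x = 0
        · simp [kx]
        obtain ⟨h1, h2⟩ := H x hx
        obtain ⟨h3, h4⟩ := K x kx
        rw [h2, hp, hq] at h4
        rw [hq] at h1
        simp only [Polynomial.eval_mul] at h1 h4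
        simp only [Polynomial.eval_mul, Polynomial.eval_sub, Polynomial.eval_zero]
        rw [div_eq_div_iff h1 h3] at h4
        linear_combination (-(h.eval x) * k.eval x) * h4
      have h5 := (mul_eq_zero.1 this).resolve_left
        (mul_ne_zero (mul_ne_zero (hne hh) (hne hk)) hg0)
      exact sub_eq_zero.1 h5
    obtain ⟨h3, h4⟩ := K t hk
    have e' := congrArg (Polynomial.eval t) e
    simp only [Polynomial.eval_mul] at e'
    rw [h4]
    field_simp
    linear_combination e'
  -- A zero of `q'` would be a zero of `p'` by `key`, against coprimality.
  have hnr : ∀ t, q'.eval t ≠ 0 := by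
    intro t ht
    obtain ⟨a, b, hab⟩ := hpq
    have := key t
    rw [ht, mul_zero] at this
    have h1 := congrArg (Polynomial.eval t) hab
    simp [ht, ← this] at h1
  have hnr' : ∀ t, p'.eval t ≠ 0 := fun t => key t ▸ mul_ne_zero (h0 t) (hnr t)
  have hC : ∀ r : Polynomial ℂ, (∀ t, r.eval t ≠ 0) → ∃ c, r = Polynomial.C c := by
    intro r hr
    refine ⟨_, Polynomial.eq_C_of_degree_eq_zero ?_⟩
    by_contra hd
    obtain ⟨t, ht⟩ := IsAlgClosed.exists_root r hd
    exact hr t ht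
  obtain ⟨a, ha⟩ := hC _ hnr'
  obtain ⟨b, hb⟩ := hC _ hnr
  refine ⟨a / b, fun t => ?_⟩
  have h1 := key t
  have h2 := hnr t
  rw [ha, hb, Polynomial.eval_C, Polynomial.eval_C] at h1
  rw [hb, Polynomial.eval_C] at h2
  rw [← h1]
  field_simp

/-- On the line `t ↦ t x` the map is a zero-free local quotient of polynomials in one variable,
hence constant; compare `t = 0` with `t = 1`. -/
theorem IsRegularMap.exists_eq_const {n : ℕ} {p : (Fin n → ℂ) → ℂˣ}
    (hp : IsRegularMap (affine n) punctured p) : ∃ c : ℂˣ, ∀ x, p x = c := by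
  refine ⟨p 0, fun x => ?_⟩
  have hr := isRegularOn_ofCoordinates_iff.1 hp.isRegularOn_val
  obtain ⟨c, hc⟩ := exists_eq_const_of_locally_quotient
    (fun t => (p (fun i => 0 + x i * t) : ℂ)) (fun _ => Units.ne_zero _) (fun t => by
      obtain ⟨h, a, b, hh, H⟩ := hr (fun i => 0 + x i * t) trivial
      let L := MvPolynomial.aeval (R := ℂ) fun i => Polynomial.C ((0 : Fin n → ℂ) i) +
          Polynomial.C (x i) * Polynomial.X
      refine ⟨L h, L a, L b, (eval_line 0 x h t).trans_ne hh, fun s hs => ?_⟩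
      rw [eval_line] at hs
      have := (H _ hs).2
      simp only [L, eval_line]
      exact this)
  have h0 := hc 0
  have h1 := hc 1
  simp only [mul_zero, mul_one, zero_add] at h0 h1
  exact Units.ext (h1.trans h0.symm)

/-! ### The Euclidean topology -/

theorem IsRegularMap.continuous {S : SpaceWithFunctions X} {T : SpaceWithFunctions Y} {f : X → Y}
    (hf : IsRegularMap S T f) : @Continuous S.Analytic T.Analytic _ _ f := by
  refine continuous_generateFrom_iff.2 ?_
  rintro _ ⟨g, U, B, hg, hB, rfl⟩
  exact TopologicalSpace.isOpen_generateFrom_of_mem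
    ⟨g ∘ f, f ⁻¹' U, B, hf.isRegularOn_comp hg, hB, rfl⟩

theorem isOpen_analytic {S : SpaceWithFunctions X} {U : Set X} (hU : IsOpen[S.zariski] U) :
    @IsOpen S.Analytic _ U :=
  TopologicalSpace.isOpen_generateFrom_of_mem
    ⟨fun _ => 0, U, Set.univ, S.const 0 hU, isOpen_univ, by simp⟩

theorem IsRegularOn.continuous {S : SpaceWithFunctions X} {g : X → ℂ}
    (hg : S.IsRegularOn g Set.univ) : @Continuous S.Analytic ℂ _ _ g :=
  continuous_def.2 fun B hB => TopologicalSpace.isOpen_generateFrom_of_mem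
    ⟨g, Set.univ, B, hg, hB, (Set.univ_inter _).symm⟩

/-- A map into a variety that is induced by coordinates is continuous at a point if its
coordinates are. -/
theorem continuousAt_ofCoordinates {ι : Type*} {c : X → ι → ℂ} {A : Type*}
    [TopologicalSpace A] {F : A → (ofCoordinates c).Analytic} {a : A}
    (hF : ∀ i, ContinuousAt (fun x => c (F x) i) a) : ContinuousAt F a := by
  have hp : ∀ p : MvPolynomial ι ℂ, ContinuousAt (fun x => MvPolynomial.eval (c (F x)) p) a := by
    intro p
    induction p using MvPolynomial.induction_on with
    | C r => simpa using continuousAt_const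
    | add p q hp hq => simp only [map_add]; exact hp.add hq
    | mul_X p i hp => simp only [map_mul, MvPolynomial.eval_X]; exact hp.mul (hF i)
  refine TopologicalSpace.tendsto_nhds_generateFrom_iff.2 ?_
  rintro _ ⟨g, U, B, hg, hB, rfl⟩ ⟨haU, haB⟩
  obtain ⟨h, p, q, hh, H⟩ := isRegularOn_ofCoordinates_iff.1 hg _ haU
  have h1 := H _ hh
  have hev := (hp h).eventually_ne hh
  have hq : ContinuousAt (fun x => MvPolynomial.eval (c (F x)) p / MvPolynomial.eval (c (F x)) q) a :=
    (hp p).div (hp q) h1.2.1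
  have hB' := hq.preimage_mem_nhds (hB.mem_nhds (h1.2.2 ▸ haB))
  filter_upwards [hev, hB'] with x hx hxB
  exact ⟨(H _ hx).1, Set.mem_preimage.2 ((H _ hx).2.2 ▸ hxB)⟩

/-- A regular function is holomorphic along a map with holomorphic coordinates. -/
theorem differentiableAt_of_isRegularOn_ofCoordinates {ι : Type*} {c : X → ι → ℂ} {A : Type*}
    [NormedAddCommGroup A] [NormedSpace ℂ A] {F : A → X} {a : A}
    (hF : ∀ i, DifferentiableAt ℂ (fun x => c (F x) i) a) {g : X → ℂ} {U : Set X}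
    (hg : (ofCoordinates c).IsRegularOn g U) (ha : F a ∈ U) :
    DifferentiableAt ℂ (fun x => g (F x)) a := by
  have hp : ∀ p : MvPolynomial ι ℂ,
      DifferentiableAt ℂ (fun x => MvPolynomial.eval (c (F x)) p) a := by
    intro p
    induction p using MvPolynomial.induction_on with
    | C r => simp
    | add p q hp hq => simp only [map_add]; exact hp.add hq
    | mul_X p i hp => simp only [map_mul, MvPolynomial.eval_X]; exact hp.mul (hF i)
  obtain ⟨h, p, q, hh, H⟩ := isRegularOn_ofCoordinates_iff.1 hg _ ha
  refine DifferentiableAt.congr_of_eventuallyEq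
    ((hp p).fun_mul (DifferentiableAt.fun_inv (hp q) (H _ hh).2.1)) ?_
  filter_upwards [(hp h).continuousAt.eventually_ne hh] with x hx
  exact (H _ hx).2.2.trans (div_eq_mul_inv _ _)

end SpaceWithFunctions

/-! ### Holomorphic curves in affine varieties -/

section Curves

open Polynomial

/-- If a polynomial `F` takes infinitely many values on the zero set of `I`, then this zero set has
a point over a finite extension of `ℂ(T)` at which `F` has the value `T`. -/
theorem exists_point_over_finite_extension {σ : Type} [Finite σ]
    (I : Ideal (MvPolynomial σ ℂ)) (F : MvPolynomial σ ℂ)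
    (hF : {z : ℂ | ∃ v : σ → ℂ, (∀ p ∈ I, MvPolynomial.eval v p = 0) ∧
      MvPolynomial.eval v F = z}.Infinite) :
    ∃ (L : Type) (_ : Field L) (_ : Algebra ℂ[X] L) (_ : Algebra (FractionRing ℂ[X]) L)
      (_ : IsScalarTower ℂ[X] (FractionRing ℂ[X]) L) (_ : Module.Finite (FractionRing ℂ[X]) L)
      (x : σ → L),
      (∀ p ∈ I, MvPolynomial.eval₂ ((algebraMap ℂ[X] L).comp C) x p = 0) ∧
        MvPolynomial.eval₂ ((algebraMap ℂ[X] L).comp C) x F = algebraMap ℂ[X] L X := by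
  set A := {z : ℂ | ∃ v : σ → ℂ, (∀ p ∈ I, MvPolynomial.eval v p = 0) ∧
      MvPolynomial.eval v F = z}
  have : Infinite A := hF.to_subtype
  choose v hvI hvF using fun a : A => a.2
  -- Germs along a nonprincipal ultrafilter on the set of values form a field. The inclusion of `A`
  -- in `ℂ` is a transcendental germ there, since a nonzero polynomial has finitely many roots, and
  -- the points `v a` form one point over this field at which `F` equals that germ.
  let π := Filter.Germ.coeRingHom (R := ℂ) (Filter.hyperfilter A : Filter A)
  let g : ℂ[X] →+* Filter.Germ (Filter.hyperfilter A : Filter A) ℂ :=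
    π.comp (RingHom.pi fun a => evalRingHom a.1)
  have hg : Function.Injective g := by
    refine (injective_iff_map_eq_zero g).2 fun P hP => ?_
    have h1 : ∀ᶠ a in (Filter.hyperfilter A : Filter A), P.eval a.1 = 0 := Filter.Germ.coe_eq.1 hP
    have h2 : {a : A | P.eval a.1 = 0}.Infinite := fun hfin =>
      Filter.notMem_hyperfilter_of_finite hfin h1
    refine Polynomial.eq_zero_of_infinite_isRoot P
      ((h2.image Subtype.val_injective.injOn).mono ?_)
    rintro _ ⟨a, ha, rfl⟩
    exact ha
  let K := FractionRing ℂ[X]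
  let ev : MvPolynomial σ K →+* Filter.Germ (Filter.hyperfilter A : Filter A) ℂ :=
    MvPolynomial.eval₂Hom (IsFractionRing.lift hg) fun i => π fun a => v a i
  let ι : MvPolynomial σ ℂ →+* MvPolynomial σ K :=
    MvPolynomial.map ((algebraMap ℂ[X] K).comp C)
  have hev : ∀ p, ev (ι p) = π fun a => MvPolynomial.eval (v a) p := by
    intro p
    have : ev.comp ι = π.comp (RingHom.pi fun a => MvPolynomial.eval (v a)) := by
      refine MvPolynomial.ringHom_ext (fun r => ?_) fun i => ?_
      · simp only [ev, ι, RingHom.comp_apply, MvPolynomial.map_C, MvPolynomial.coe_eval₂Hom,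
          MvPolynomial.eval₂_C, IsFractionRing.lift_algebraMap, g]
        exact congrArg π (funext fun a => by simp)
      · simp only [ev, ι, RingHom.comp_apply, MvPolynomial.map_X, MvPolynomial.coe_eval₂Hom,
          MvPolynomial.eval₂_X]
        exact congrArg π (funext fun a => by simp)
    exact congrArg (fun f => f p) this
  -- The ultrapower is too large; a maximal ideal over the relations of the point keeps all its
  -- equations, and Zariski's lemma makes the residue field finite over `ℂ(T)`.
  obtain ⟨𝔪, h𝔪, hle⟩ := Ideal.exists_le_maximal (RingHom.ker ev) (RingHom.ker_ne_top ev)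
  let L := MvPolynomial σ K ⧸ 𝔪
  let : Field L := Ideal.Quotient.field 𝔪
  have hx : ∀ p, MvPolynomial.eval₂ ((algebraMap ℂ[X] L).comp C)
      (fun i => Ideal.Quotient.mk 𝔪 (MvPolynomial.X i)) p = Ideal.Quotient.mk 𝔪 (ι p) := by
    intro p
    have : MvPolynomial.eval₂Hom ((algebraMap ℂ[X] L).comp C)
      (fun i => Ideal.Quotient.mk 𝔪 (MvPolynomial.X i)) = (Ideal.Quotient.mk 𝔪).comp ι := by
      refine MvPolynomial.ringHom_ext (fun r => ?_) fun i => ?_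
      · simp only [MvPolynomial.coe_eval₂Hom, MvPolynomial.eval₂_C, ι, RingHom.comp_apply,
          MvPolynomial.map_C]
        rfl
      · simp [ι]
    exact congrArg (fun f => f p) this
  refine ⟨L, inferInstance, inferInstance, inferInstance, inferInstance,
    finite_of_finite_type_of_isJacobsonRing K L,
    fun i => Ideal.Quotient.mk 𝔪 (MvPolynomial.X i), fun p hp => ?_, ?_⟩
  · rw [hx, Ideal.Quotient.eq_zero_iff_mem]
    refine hle ?_
    rw [RingHom.mem_ker, hev]
    simp only [hvI _ p hp]
    exact map_zero π
  · rw [hx]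
    refine Ideal.Quotient.eq.2 (hle (x := ι F - MvPolynomial.C (algebraMap ℂ[X] K X)) ?_)
    rw [RingHom.mem_ker, map_sub, hev, sub_eq_zero]
    simp only [ev, MvPolynomial.coe_eval₂Hom, MvPolynomial.eval₂_C,
      IsFractionRing.lift_algebraMap, g, hvF]
    exact congrArg π (funext fun a => by simp)

/-- An affine variety on which `F` takes infinitely many values contains a rational image of a plane
curve `m(T, y) = 0`, finite and generically étale over the `T`-line, along which `F = T`. -/
theorem exists_plane_curve {σ : Type} [Finite σ]
    (I : Ideal (MvPolynomial σ ℂ)) (F : MvPolynomial σ ℂ)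
    (hF : {z : ℂ | ∃ v : σ → ℂ, (∀ p ∈ I, MvPolynomial.eval v p = 0) ∧
      MvPolynomial.eval v F = z}.Infinite) :
    ∃ (m a b : ℂ[X][X]) (δ : ℂ[X]) (w : σ → ℂ[X][X]) (d : σ → ℂ[X]),
      m.Monic ∧ m.natDegree ≠ 0 ∧ δ ≠ 0 ∧ a * m + b * derivative m = C δ ∧ (∀ i, d i ≠ 0) ∧
      ∀ T y : ℂ, (∀ i, (d i).eval T ≠ 0) → m.evalEval T y = 0 →
        (∀ p ∈ I, MvPolynomial.eval (fun i => (w i).evalEval T y / (d i).eval T) p = 0) ∧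
        MvPolynomial.eval (fun i => (w i).evalEval T y / (d i).eval T) F = T := by
  obtain ⟨L, _, _, _, _, _, x, hxI, hxF⟩ := exists_point_over_finite_extension I F hF
  set K := FractionRing ℂ[X]
  have hinj : Function.Injective (algebraMap ℂ[X] L) := by
    rw [IsScalarTower.algebraMap_eq ℂ[X] K L]
    exact (algebraMap K L).injective.comp (IsFractionRing.injective ℂ[X] K)
  obtain ⟨β, hβ⟩ := Field.exists_primitive_element K L
  -- A multiple of the primitive element is integral over `ℂ[T]`, so that its minimal polynomial
  -- over `ℂ[T]` is monic.
  obtain ⟨c, hc, hα⟩ := ((IsFractionRing.isAlgebraic_iff ℂ[X] K L).2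
    (Algebra.IsAlgebraic.isAlgebraic (R := K) β)).exists_integral_multiple
  set α := c • β with hα_def
  have hαβ : IntermediateField.adjoin K {α} = ⊤ := by
    rw [eq_top_iff, ← hβ, IntermediateField.adjoin_simple_le_iff]
    have h1 : algebraMap ℂ[X] K c ≠ 0 := by
      simpa using hc
    have h2 : β = (algebraMap ℂ[X] K c)⁻¹ • α := by
      rw [hα_def, ← algebraMap_smul K c β, smul_smul, inv_mul_cancel₀ h1, one_smul]
    rw [h2]
    exact (IntermediateField.adjoin K {α}).smul_mem
      (IntermediateField.mem_adjoin_simple_self K α)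
  -- Since `K(α) = K[α]`, it remains to clear the denominators of the coefficients.
  have hpoly : ∀ z : L, ∃ (d : ℂ[X]) (w : ℂ[X][X]), d ≠ 0 ∧ aeval α w = d • z := by
    intro z
    have hz : z ∈ (IntermediateField.adjoin K {α}).toSubalgebra := by
      rw [hαβ]
      trivial
    rw [IntermediateField.adjoin_simple_toSubalgebra_of_isAlgebraic
      (Algebra.IsAlgebraic.isAlgebraic (R := K) α), Algebra.adjoin_singleton_eq_range_aeval] at hz
    obtain ⟨r, rfl⟩ := hz
    obtain ⟨d, hd, h⟩ := IsLocalization.integerNormalization_spec (nonZeroDivisors ℂ[X]) r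
    refine ⟨d, IsLocalization.integerNormalization (nonZeroDivisors ℂ[X]) r,
      nonZeroDivisors.ne_zero hd, ?_⟩
    rw [← aeval_map_algebraMap K, h, ← algebraMap_smul K d r, map_smul, algebraMap_smul]
    rfl
  choose d w hd hw using fun i => hpoly (x i)
  have : Module.IsTorsionFree ℂ[X] L := 
    Module.isTorsionFree_iff_algebraMap_injective.2 hinj
  set m := minpoly ℂ[X] α
  have hm : m.Monic := minpoly.monic hα
  have hmK : minpoly K α = m.map (algebraMap ℂ[X] K) :=
    minpoly.isIntegrallyClosed_eq_field_fractions' K hα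
  -- Separability in characteristic zero gives a Bézout identity over `ℂ(T)`. With denominators
  -- cleared, `δ` plays the role of a discriminant: where it is nonzero, the roots of `m` are
  -- simple.
  obtain ⟨a, b, δ, hδ, hab⟩ : ∃ (a b : ℂ[X][X]) (δ : ℂ[X]), δ ≠ 0 ∧
      a * m + b * derivative m = C δ := by
    have hsep : (minpoly K α).Separable := Algebra.IsSeparable.isSeparable K α
    obtain ⟨a, b, hab⟩ := hsep
    obtain ⟨d1, hd1, h1⟩ := IsLocalization.integerNormalization_spec (nonZeroDivisors ℂ[X]) a
    obtain ⟨d2, hd2, h2⟩ := IsLocalization.integerNormalization_spec (nonZeroDivisors ℂ[X]) b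
    refine ⟨C d2 * IsLocalization.integerNormalization (nonZeroDivisors ℂ[X]) a,
      C d1 * IsLocalization.integerNormalization (nonZeroDivisors ℂ[X]) b, d1 * d2,
      mul_ne_zero (nonZeroDivisors.ne_zero hd1) (nonZeroDivisors.ne_zero hd2), ?_⟩
    refine Polynomial.map_injective _ (IsFractionRing.injective ℂ[X] K) ?_
    rw [hmK, derivative_map] at hab
    simp only [Polynomial.map_add, Polynomial.map_mul, h1, h2, Polynomial.map_C, map_mul]
    have e : ∀ (d : ℂ[X]) (p : K[X]), d • p = C (algebraMap ℂ[X] K d) * p := by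
      intro d p
      rw [← algebraMap_smul K d p, smul_eq_C_mul]
    rw [e, e]
    linear_combination (C (algebraMap ℂ[X] K d1) * C (algebraMap ℂ[X] K d2)) * hab
  -- One polynomial `u` represents `N * Q` both at the point over `L` and at numerical `(T, y)`. A
  -- relation over `L` makes `m` divide `u`, hence holds at every point of the curve where no `d i`
  -- vanishes.
  have key : ∀ Q : MvPolynomial σ ℂ, ∃ (N : ℂ[X]) (u : ℂ[X][X]),
      aeval α u = algebraMap ℂ[X] L N * MvPolynomial.eval₂ ((algebraMap ℂ[X] L).comp C) x Q ∧
      ∀ T y : ℂ, (∀ i, (d i).eval T ≠ 0) → N.eval T ≠ 0 ∧ u.evalEval T y =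
        N.eval T * MvPolynomial.eval (fun i => (w i).evalEval T y / (d i).eval T) Q := by
    intro Q
    induction Q using MvPolynomial.induction_on with
    | C r => exact ⟨1, C (C r), by simp, fun T y _ => by simp⟩
    | add p q hp hq =>
      obtain ⟨N, u, h1, h2⟩ := hp
      obtain ⟨N', u', h1', h2'⟩ := hq
      refine ⟨N * N', C N' * u + C N * u', ?_, fun T y hT => ?_⟩
      · simp only [map_add, map_mul, h1, h1', aeval_C, MvPolynomial.eval₂_add]
        ring
      · obtain ⟨h3, h4⟩ := h2 T y hT
        obtain ⟨h3', h4'⟩ := h2' T y hT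
        refine ⟨by simp [h3, h3'], ?_⟩
        simp only [evalEval_add, evalEval_mul, evalEval_C, h4, h4', eval_mul, map_add]
        ring
    | mul_X p i hp =>
      obtain ⟨N, u, h1, h2⟩ := hp
      refine ⟨N * d i, u * w i, ?_, fun T y hT => ?_⟩
      · simp only [map_mul, h1, hw, MvPolynomial.eval₂_mul, MvPolynomial.eval₂_X,
          Algebra.smul_def]
        ring
      · obtain ⟨h3, h4⟩ := h2 T y hT
        refine ⟨by simp [h3, hT i], ?_⟩
        simp only [evalEval_mul, h4, eval_mul, map_mul, MvPolynomial.eval_X]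
        have := hT i
        field_simp
  refine ⟨m, a, b, δ, w, d, hm, (minpoly.natDegree_pos hα).ne', hδ, hab, hd,
    fun T y hT hy => ⟨fun p hp => ?_, ?_⟩⟩
  · obtain ⟨N, u, h1, h2⟩ := key p
    rw [hxI p hp, mul_zero] at h1
    have h3 := evalEval_dvd T y (minpoly.isIntegrallyClosed_dvd hα h1)
    obtain ⟨h4, h5⟩ := h2 T y hT
    rw [hy, zero_dvd_iff, h5] at h3
    exact (mul_eq_zero.1 h3).resolve_left h4
  · obtain ⟨N, u, h1, h2⟩ := key F
    rw [hxF, ← map_mul] at h1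
    have h1' : aeval α (u - C (N * X)) = 0 := by
      rw [map_sub, h1, aeval_C, sub_self]
    have h3 := evalEval_dvd T y (minpoly.isIntegrallyClosed_dvd hα h1')
    obtain ⟨h4, h5⟩ := h2 T y hT
    rw [hy, zero_dvd_iff, evalEval_sub, h5, evalEval_C, eval_mul, eval_X, ← mul_sub] at h3
    exact sub_eq_zero.1 ((mul_eq_zero.1 h3).resolve_left h4)

theorem contDiff_evalEval (p : ℂ[X][X]) {n : WithTop ℕ∞} :
    ContDiff ℂ n fun u : ℂ × ℂ => p.evalEval u.1 u.2 := by
  induction p using Polynomial.induction_on' with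
  | add p q hp hq => simpa only [evalEval_add] using hp.add hq
  | monomial k r =>
    have : ∀ u : ℂ × ℂ, (monomial k r).evalEval u.1 u.2 = r.eval u.1 * u.2 ^ k := by
      intro u
      rw [← C_mul_X_pow_eq_monomial, evalEval_mul, evalEval_C, evalEval_pow, evalEval_X]
    simp only [this]
    exact (r.contDiff_aeval n |>.comp contDiff_fst).mul (contDiff_snd.pow k)

theorem hasDerivAt_evalEval (p : ℂ[X][X]) (T y : ℂ) :
    HasDerivAt (fun z => p.evalEval T z) ((derivative p).evalEval T y) y := by
  have := (p.map (evalRingHom T)).hasDerivAt y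
  rw [derivative_map] at this
  simpa only [map_evalRingHom_eval] using this

/-- A simple root of a polynomial depends holomorphically on the coefficients. -/
theorem exists_holomorphic_root (m : ℂ[X][X]) {T₀ y₀ : ℂ} (h0 : m.evalEval T₀ y₀ = 0)
    (h1 : (derivative m).evalEval T₀ y₀ ≠ 0) : ∃ y : ℂ → ℂ,
      ∀ᶠ t in 𝓝 T₀, DifferentiableAt ℂ y t ∧ m.evalEval t (y t) = 0 := by
  have hcd : ContDiffAt ℂ 1 (fun u : ℂ × ℂ => m.evalEval u.1 u.2) (T₀, y₀) :=
    (contDiff_evalEval m).contDiffAt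
  -- The partial derivative in `y` is multiplication by the nonzero number in `h1`.
  have hinv : (fderiv ℂ (fun u : ℂ × ℂ => m.evalEval u.1 u.2) (T₀, y₀) ∘L
      .inr ℂ ℂ ℂ).IsInvertible := by
    refine ⟨ContinuousLinearEquiv.unitsEquivAut ℂ (Units.mk0 _ h1), ?_⟩
    have h2 : HasFDerivAt (fun z : ℂ => m.evalEval T₀ z)
        (fderiv ℂ (fun u : ℂ × ℂ => m.evalEval u.1 u.2) (T₀, y₀) ∘L .inr ℂ ℂ ℂ) y₀ :=
      (hcd.differentiableAt one_ne_zero).hasFDerivAt.comp y₀ (hasFDerivAt_prodMk_right T₀ y₀)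
    rw [h2.unique (hasDerivAt_evalEval m T₀ y₀).hasFDerivAt]
    ext
    simp
  refine ⟨hcd.implicitFunction one_ne_zero hinv, ?_⟩
  filter_upwards [hcd.eventually_apply_implicitFunction one_ne_zero hinv,
    (hcd.contDiffAt_implicitFunction one_ne_zero hinv).eventually (by simp)] with t ht ht'
  exact ⟨ht'.differentiableAt one_ne_zero, ht.trans h0⟩

/-- A polynomial that takes infinitely many values on an affine variety has a local holomorphic
section. -/
theorem exists_holomorphic_section {σ : Type} [Finite σ]
    (I : Ideal (MvPolynomial σ ℂ)) (F : MvPolynomial σ ℂ)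
    (hF : {z : ℂ | ∃ v : σ → ℂ, (∀ p ∈ I, MvPolynomial.eval v p = 0) ∧
      MvPolynomial.eval v F = z}.Infinite) :
    ∃ (T₀ : ℂ) (v : ℂ → σ → ℂ), ∀ᶠ t in 𝓝 T₀, (∀ i, DifferentiableAt ℂ (fun s => v s i) t) ∧
      (∀ p ∈ I, MvPolynomial.eval (v t) p = 0) ∧ MvPolynomial.eval (v t) F = t := by
  cases nonempty_fintype σ
  obtain ⟨m, a, b, δ, w, d, hm, hm0, hδ, hab, hd, H⟩ := exists_plane_curve I F hF
  obtain ⟨T₀, hT₀⟩ : ∃ T : ℂ, (δ * ∏ i, d i).eval T ≠ 0 := by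
    by_contra! h
    exact mul_ne_zero hδ (Finset.prod_ne_zero_iff.2 fun i _ => hd i)
      (Polynomial.funext fun x => by rw [h, eval_zero])
  rw [eval_mul, eval_prod, mul_ne_zero_iff, Finset.prod_ne_zero_iff] at hT₀
  obtain ⟨y₀, hy₀⟩ := IsAlgClosed.exists_root (m.map (evalRingHom T₀)) (by
    rw [hm.degree_map, degree_eq_natDegree hm.ne_zero]
    exact_mod_cast hm0)
  have hy : m.evalEval T₀ y₀ = 0 := by rwa [IsRoot, map_evalRingHom_eval] at hy₀
  -- A multiple root over `T₀` would make `δ` vanish there, by the Bézout identity.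
  obtain ⟨y, hy⟩ := exists_holomorphic_root m hy fun h => hT₀.1 (by
    have := congrArg (evalEval T₀ y₀) hab
    rw [evalEval_add, evalEval_mul, evalEval_mul, hy, h, evalEval_C] at this
    simpa using this.symm)
  refine ⟨T₀, fun t i => (w i).evalEval t (y t) / (d i).eval t, ?_⟩
  have hd' : ∀ᶠ t in 𝓝 T₀, ∀ i, (d i).eval t ≠ 0 := Filter.eventually_all.2 fun i =>
    (d i).continuous.continuousAt.eventually_ne (hT₀.2 i (Finset.mem_univ i))
  filter_upwards [hy, hd'] with t ht ht'
  refine ⟨fun i => ?_, H t (y t) ht' ht.2⟩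
  have h1 : DifferentiableAt ℂ (fun s => (w i).evalEval s (y s)) t :=
    DifferentiableAt.comp t (g := fun u : ℂ × ℂ => (w i).evalEval u.1 u.2)
      (((contDiff_evalEval (w i) (n := 1)).differentiable one_ne_zero) (t, y t))
      (differentiableAt_id.prodMk ht.1)
  exact DifferentiableAt.fun_div (𝕜 := ℂ) h1 (d i).differentiableAt (ht' i)

end Curves

namespace SpaceWithFunctions

variable {X : Type u} {Y : Type v}

/-! ### Holomorphic curves in linear algebraic groups -/

/-- The members of a closed subgroup of `GL_N(ℂ)` at which a polynomial `k` does not vanish form an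
affine variety; a quotient of polynomials with infinitely many values on it has a local holomorphic
section. -/
theorem exists_section_matrixGroup {N : ℕ} {G : Subgroup (Matrix.GeneralLinearGroup (Fin N) ℂ)}
    (hG : IsClosed[(generalLinear N).zariski] (G : Set (Matrix.GeneralLinearGroup (Fin N) ℂ)))
    (χ : G → ℂ) (k p q : MvPolynomial (Fin N × Fin N) ℂ)
    (H : ∀ g : G, MvPolynomial.eval (fun ij => g.1.1 ij.1 ij.2) k ≠ 0 →
      MvPolynomial.eval (fun ij => g.1.1 ij.1 ij.2) q ≠ 0 ∧
        χ g = MvPolynomial.eval (fun ij => g.1.1 ij.1 ij.2) p /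
          MvPolynomial.eval (fun ij => g.1.1 ij.1 ij.2) q)
    (hinf : (χ '' {g | MvPolynomial.eval (fun ij => g.1.1 ij.1 ij.2) k ≠ 0}).Infinite) :
    ∃ (T₀ : ℂ) (γ : ℂ → G), ∀ᶠ t in 𝓝 T₀,
      (∀ ij : Fin N × Fin N, DifferentiableAt ℂ (fun s => (γ s).1.1 ij.1 ij.2) t) ∧
        χ (γ t) = t := by
  let D : MvPolynomial (Fin N × Fin N) ℂ :=
    (Matrix.of fun i j => MvPolynomial.X (i, j) : Matrix (Fin N) (Fin N) _).det
  have hD : ∀ M : Fin N × Fin N → ℂ,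
      MvPolynomial.eval M D = (Matrix.of fun i j => M (i, j)).det := by
    intro M
    rw [RingHom.map_det]
    congr 1
    ext i j
    simp
  let R := MvPolynomial.rename (R := ℂ) (Sum.inl : Fin N × Fin N → (Fin N × Fin N) ⊕ Unit)
  have hR : ∀ (v : (Fin N × Fin N) ⊕ Unit → ℂ) (f : MvPolynomial (Fin N × Fin N) ℂ),
      MvPolynomial.eval v (R f) = MvPolynomial.eval (fun ij => v (Sum.inl ij)) f :=
    fun v f => MvPolynomial.eval_rename _ _ _
  let I₀ : Set (MvPolynomial (Fin N × Fin N) ℂ) :=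
    {f | ∀ g ∈ G, MvPolynomial.eval (fun ij => g.1 ij.1 ij.2) f = 0}
  have hI₀ : ∀ g : Matrix.GeneralLinearGroup (Fin N) ℂ,
      (∀ f ∈ I₀, MvPolynomial.eval (fun ij => g.1 ij.1 ij.2) f = 0) → g ∈ G := by
    intro g hg
    by_contra hgG
    obtain ⟨f, hf, hfG⟩ := exists_eval_ne_zero_subset
      (c := fun (g : Matrix.GeneralLinearGroup (Fin N) ℂ) (ij : Fin N × Fin N) =>
        (g : Matrix (Fin N) (Fin N) ℂ) ij.1 ij.2) hG.isOpen_compl hgG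
    refine hf (hg f fun a ha => ?_)
    by_contra h
    exact hfG a h ha
  -- Rabinowitsch's trick: the extra variable is an inverse of `D * k * q`. This makes the locus
  -- closed in affine space, and `χ = p / q` becomes the polynomial `F` on it.
  let U : MvPolynomial ((Fin N × Fin N) ⊕ Unit) ℂ :=
    MvPolynomial.X (Sum.inr ()) * R (D * k * q) - 1
  let I := Ideal.span (R '' I₀ ∪ {U})
  let F := MvPolynomial.X (Sum.inr ()) * R (D * k * p)
  have hpt : ∀ v : (Fin N × Fin N) ⊕ Unit → ℂ, (∀ f ∈ I, MvPolynomial.eval v f = 0) →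
      ∃ g : G, (∀ ij : Fin N × Fin N, g.1.1 ij.1 ij.2 = v (Sum.inl ij)) ∧
        χ g = MvPolynomial.eval v F := by
    intro v hv
    have h1 : v (Sum.inr ()) * MvPolynomial.eval (fun ij => v (Sum.inl ij)) (D * k * q) = 1 := by
      have := hv U (Ideal.subset_span (Or.inr rfl))
      simp only [U, map_sub, map_mul, map_one, MvPolynomial.eval_X, hR] at this
      rw [map_mul, map_mul]
      exact sub_eq_zero.1 this
    have h2 : MvPolynomial.eval (fun ij => v (Sum.inl ij)) (D * k * q) ≠ 0 :=
      right_ne_zero_of_mul (h1.trans_ne one_ne_zero)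
    rw [map_mul, map_mul, mul_ne_zero_iff, mul_ne_zero_iff, hD] at h2
    let g : Matrix.GeneralLinearGroup (Fin N) ℂ :=
      Matrix.GeneralLinearGroup.mkOfDetNeZero (Matrix.of fun i j => v (Sum.inl (i, j))) h2.1.1
    have hg : (fun ij : Fin N × Fin N => g.1 ij.1 ij.2) = fun ij => v (Sum.inl ij) := rfl
    have hgG : g ∈ G := by
      refine hI₀ g fun f hf => ?_
      rw [hg, ← hR]
      exact hv _ (Ideal.subset_span (Or.inl ⟨f, hf, rfl⟩))
    refine ⟨⟨g, hgG⟩, fun ij => rfl, ?_⟩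
    obtain ⟨h3, h4⟩ := H ⟨g, hgG⟩ h2.1.2
    rw [h4, div_eq_iff h3]
    change MvPolynomial.eval (fun ij => v (Sum.inl ij)) p = _ *
      MvPolynomial.eval (fun ij => v (Sum.inl ij)) q
    simp only [F, map_mul, MvPolynomial.eval_X, hR] at h1 ⊢
    linear_combination (-MvPolynomial.eval (fun ij => v (Sum.inl ij)) p) * h1
  obtain ⟨T₀, v, hv⟩ := exists_holomorphic_section I F (hinf.mono (by
    rintro _ ⟨g, hg, rfl⟩
    obtain ⟨h1, h2⟩ := H g hg
    have hdet : MvPolynomial.eval (fun ij : Fin N × Fin N => g.1.1 ij.1 ij.2) D ≠ 0 := by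
      rw [hD]
      exact ((Matrix.isUnit_iff_isUnit_det _).1 g.1.isUnit).ne_zero
    let s := (MvPolynomial.eval (fun ij : Fin N × Fin N => g.1.1 ij.1 ij.2) (D * k * q))⁻¹
    have hs : s * MvPolynomial.eval (fun ij : Fin N × Fin N => g.1.1 ij.1 ij.2) (D * k * q) = 1 :=
      inv_mul_cancel₀ (by
        rw [map_mul, map_mul]
        exact mul_ne_zero (mul_ne_zero hdet hg) h1)
    refine ⟨Sum.elim (fun ij => g.1.1 ij.1 ij.2) fun _ => s, fun f hf => ?_, ?_⟩
    · have : I ≤ RingHom.ker (MvPolynomial.eval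
          (Sum.elim (fun ij : Fin N × Fin N => g.1.1 ij.1 ij.2) fun _ => s)) := by
        refine Ideal.span_le.2 (Set.union_subset ?_ ?_)
        · rintro _ ⟨f, hf, rfl⟩
          exact (hR _ f).trans (hf g.1 g.2)
        · rintro _ rfl
          refine RingHom.mem_ker.2 ?_
          simp only [U, map_sub, map_one, MvPolynomial.eval_X, hR,
            map_mul (MvPolynomial.eval _) (MvPolynomial.X _), Sum.elim_inr, Sum.elim_inl]
          rw [hs, sub_self]
      exact this hf
    · simp only [F, MvPolynomial.eval_X, hR,
            map_mul (MvPolynomial.eval _) (MvPolynomial.X _), Sum.elim_inr, Sum.elim_inl]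
      rw [h2, eq_div_iff h1]
      simp only [map_mul] at hs ⊢
      linear_combination MvPolynomial.eval (fun ij : Fin N × Fin N => g.1.1 ij.1 ij.2) p * hs))
  obtain ⟨γ, hγ⟩ := (hv.mono fun t ht => hpt (v t) ht.2.1).choice
  refine ⟨T₀, γ, ?_⟩
  -- Differentiability at `t` requires the entries of `γ` to agree with `v` on a neighbourhood of
  -- `t`, not just at `t`.
  filter_upwards [hv, hγ, hγ.eventually_nhds] with t h1 h2 h3
  refine ⟨fun ij => (h1.1 (Sum.inl ij)).congr_of_eventuallyEq ?_, h2.2.trans h1.2.2⟩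
  filter_upwards [h3] with s hs
  exact hs.1 ij

/-- A nonvanishing regular function with infinitely many values on a linear algebraic group has a
local holomorphic section. -/
theorem IsLinearAlgebraicGroup.exists_section {G : Type u} [Group G] {S : SpaceWithFunctions G}
    (hG : IsLinearAlgebraicGroup S) {χ : G → ℂˣ} (hχ : IsRegularMap S punctured χ)
    (hinf : (Set.range χ).Infinite) :
    ∃ (T₀ : ℂ) (γ : ℂ → G), ∀ᶠ t in 𝓝 T₀,
      (∀ (g : G → ℂ) (U : Set G), S.IsRegularOn g U → γ t ∈ U →
        DifferentiableAt ℂ (fun s => g (γ s)) t) ∧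
      @ContinuousAt ℂ S.Analytic _ _ γ t ∧ (χ (γ t) : ℂ) = t := by
  obtain ⟨N, G', hG', e, he, he'⟩ := hG
  have hχ' : IsRegularMap (matrixGroup G') punctured (χ ∘ e.symm) := hχ.comp he'
  have hr := isRegularOn_ofCoordinates_iff.1 hχ'.isRegularOn_val
  choose k p q hk hkpq using fun g : G' => hr g trivial
  -- By Hilbert's basis theorem finitely many sets `k g ≠ 0` cover the group, so `χ` has infinitely
  -- many values on one of them.
  obtain ⟨s, hs, hs'⟩ := Submodule.fg_span_iff_fg_span_finset_subset (Set.range k) |>.1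
    (IsNoetherian.noetherian (Ideal.span (Set.range k)))
  have hcover : ∀ g : G', ∃ f ∈ s, MvPolynomial.eval (fun ij => g.1.1 ij.1 ij.2) f ≠ 0 := by
    intro g
    by_contra! h
    have h1 : Ideal.span (Set.range k) ≤
        RingHom.ker (MvPolynomial.eval fun ij : Fin N × Fin N => g.1.1 ij.1 ij.2) := by
      refine hs'.le.trans (Ideal.span_le.2 fun f hf => h f hf)
    exact hk g (h1 (Ideal.subset_span ⟨g, rfl⟩))
  obtain ⟨f, hf, hfinf⟩ : ∃ f ∈ s, ((fun g : G' => (χ (e.symm g) : ℂ)) ''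
      {g | MvPolynomial.eval (fun ij => g.1.1 ij.1 ij.2) f ≠ 0}).Infinite := by
    by_contra! h
    have h1 := Set.Finite.biUnion s.finite_toSet h
    refine (hinf.image (f := fun z : ℂˣ => (z : ℂ)) Units.val_injective.injOn) (h1.subset ?_)
    rintro _ ⟨_, ⟨a, rfl⟩, rfl⟩
    obtain ⟨f, hf, hfa⟩ := hcover (e a)
    exact Set.mem_biUnion hf ⟨e a, hfa, by simp⟩
  obtain ⟨g₀, rfl⟩ := hs hf
  obtain ⟨T₀, γ, hγ⟩ := exists_section_matrixGroup hG' (fun g => (χ (e.symm g) : ℂ)) (k g₀) (p g₀)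
    (q g₀) (fun g hg => (hkpq g₀ g hg).2) hfinf
  refine ⟨T₀, fun t => e.symm (γ t), ?_⟩
  filter_upwards [hγ] with t ht
  refine ⟨fun g U hg hU => ?_, ?_, ht.2⟩
  · exact differentiableAt_of_isRegularOn_ofCoordinates (F := γ)
      (c := fun (g : G') (ij : Fin N × Fin N) => g.1.1 ij.1 ij.2) ht.1
      (he'.isRegularOn_comp hg) hU
  · exact ContinuousAt.comp (Y := (matrixGroup G').Analytic) (Z := S.Analytic) (g := e.symm)
      he'.continuous.continuousAt
      (continuousAt_ofCoordinates fun ij => (ht.1 ij).continuousAt)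

/-- A regular character with infinitely many values is surjective. -/
theorem IsLinearAlgebraicGroup.surjective_of_infinite_range {G : Type u} [Group G]
    {S : SpaceWithFunctions G} (hG : IsLinearAlgebraicGroup S) {χ : G →* ℂˣ}
    (hχ : IsRegularMap S punctured χ) (hinf : (Set.range χ).Infinite) :
    Function.Surjective χ := by
  obtain ⟨T₀, γ, hγ⟩ := hG.exists_section hχ hinf
  intro z
  obtain ⟨w, hw⟩ : ∃ w, Complex.exp w = z := ⟨_, Complex.exp_log z.ne_zero⟩
  -- For large `n` the curve reaches the value `exp (w / n) * T₀`. Dividing by `γ T₀` gives an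
  -- element with character `exp (w / n)`, whose `n`-th power has character `z`.
  have hlim : Filter.Tendsto (fun n : ℕ => Complex.exp (w / n) * T₀) Filter.atTop (𝓝 T₀) := by
    have h1 : Filter.Tendsto (fun n : ℕ => w / n) Filter.atTop (𝓝 0) :=
      tendsto_const_div_atTop_nhds_zero_nat w
    have h2 := ((Complex.continuous_exp.tendsto 0).comp h1).mul_const T₀
    simpa using h2
  obtain ⟨n, hn, hn0⟩ := ((hlim.eventually hγ).and (Filter.eventually_gt_atTop 0)).exists
  have h0 := hγ.self_of_nhds.2.2
  refine ⟨(γ (Complex.exp (w / n) * T₀) * (γ T₀)⁻¹) ^ n, Units.ext ?_⟩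
  have hT₀ : T₀ ≠ 0 := h0 ▸ Units.ne_zero _
  have hn' : (n : ℂ) ≠ 0 := by exact_mod_cast hn0.ne'
  rw [map_pow, map_mul, map_inv, Units.val_pow_eq_pow_val, Units.val_mul, Units.val_inv_eq_inv_val,
    hn.2.2, h0, mul_inv_cancel_right₀ hT₀, ← Complex.exp_nat_mul, mul_div_cancel₀ _ hn', hw]

/-! ### Tangent vectors and sprays -/

/-- The tangent vector of a holomorphic curve. -/
theorem exists_tangent_of_curve (S : SpaceWithFunctions X) (c : ℂ → X) (T₀ : ℂ)
    (hc : Filter.Tendsto c (𝓝 T₀) (@nhds X S.zariski (c T₀)))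
    (hd : ∀ (g : X → ℂ) (U : Set X), S.IsRegularOn g U → c T₀ ∈ U →
      DifferentiableAt ℂ (fun s => g (c s)) T₀) :
    ∃ D : S.tangentSpace (c T₀), ∀ (g : X → ℂ) (U : Set X) (hx : c T₀ ∈ U)
      (hg : S.IsRegularOn g U), D.1 (S.germ hx hg) = deriv (fun s => g (c s)) T₀ := by
  -- Well defined because `c` tends to `c T₀` in the Zariski topology: equal germs give functions of
  -- the parameter that agree near `T₀`.
  let δ : Filter.Germ (@nhds X S.zariski (c T₀)) ℂ → ℂ := fun φ =>
    φ.liftOn (fun f => deriv (fun s => f (c s)) T₀) fun f g hfg =>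
      Filter.EventuallyEq.deriv_eq (hc.eventually hfg)
  let D : Module.Dual ℂ (S.stalk (c T₀)) :=
    { toFun := fun φ => δ φ.1
      map_add' := by
        rintro ⟨_, f, U, hU, hf, rfl⟩ ⟨_, g, V, hV, hg, rfl⟩
        exact deriv_fun_add (hd f U hf hU) (hd g V hg hV)
      map_smul' := by
        rintro a ⟨_, f, U, hU, hf, rfl⟩
        exact deriv_const_mul a (hd f U hf hU) }
  exact ⟨⟨D, fun f g U hx hf hg => (deriv_fun_mul (hd f U hf hx) (hd g U hg hx)).trans (by
    rw [add_comm, mul_comm (deriv _ _)]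
    rfl)⟩, fun g U hx hg => rfl⟩

theorem isRegularOn_slice_of_mem_tensorFunctions {S : SpaceWithFunctions X}
    {T : SpaceWithFunctions Y} {U : Set X} {V : Set Y} (hV : IsOpen[T.zariski] V) {h : X × Y → ℂ}
    (hh : h ∈ S.tensorFunctions T U V) (x : X) : T.IsRegularOn (fun z => h (x, z)) V := by
  induction hh using Algebra.adjoin_induction with
  | mem f hf =>
    obtain ⟨a, ha, rfl⟩ | ⟨b, hb, rfl⟩ := hf
    · exact T.const (a x) hV
    · exact hb
  | algebraMap r => exact T.const _ hV
  | add f g _ _ hf hg => exact T.add hf hg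
  | mul f g _ _ hf hg => exact T.mul hf hg

/-- The inclusion of a fibre into a product with a variety that is induced by coordinates. -/
theorem isRegularMap_slice {ι : Type*} (S : SpaceWithFunctions X) (c : Y → ι → ℂ) (x : X) :
    IsRegularMap (ofCoordinates c) (S.prod (ofCoordinates c)) fun z => (x, z) := by
  have hcont : ∀ W, IsOpen[(S.prod (ofCoordinates c)).zariski] W →
      IsOpen[(ofCoordinates c).zariski] ((fun z => (x, z)) ⁻¹' W) := by
    have : @Continuous _ _ (ofCoordinates c).zariski (S.prodZariski (ofCoordinates c))
        fun z => (x, z) := by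
      refine continuous_generateFrom_iff.2 ?_
      rintro _ ⟨U, V, h, hU, hV, hh, rfl⟩
      by_cases hx : x ∈ U
      · convert isOpen_of_isRegularOn_ne_zero
          (isRegularOn_slice_of_mem_tensorFunctions hV hh x) using 1
        ext z
        simp [hx]
      · convert @isOpen_empty _ (ofCoordinates c).zariski using 1
        ext z
        simp [hx]
    exact fun W hW => @IsOpen.preimage _ _ (_) (_) _ this W hW
  refine isRegularMap_of hcont fun W g hg => SpaceWithFunctions.glue _ fun z hz => ?_
  obtain ⟨O, hO, hzO, hOW, U, V, hU, hV, hOUV, p, hp, q, hq, H⟩ := hg (x, z) hz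
  refine ⟨(fun z => (x, z)) ⁻¹' O, hzO, Set.preimage_mono hOW, ?_⟩
  refine SpaceWithFunctions.congr _ (isRegularOn_ofCoordinates_div
    (isRegularOn_slice_of_mem_tensorFunctions hV hp x)
    (isRegularOn_slice_of_mem_tensorFunctions hV hq x) (fun y hy => (hOUV hy).2) (hcont O hO)
    fun y hy => (H _ hy).1) fun y hy => (H _ hy).2.symm

/-- A regular map to the punctured line is constant along the fibres of a spray. -/
theorem AlgebraicSpray.comp_map_eq {S : SpaceWithFunctions Y} (s : AlgebraicSpray S) {ψ : Y → ℂˣ}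
    (hψ : IsRegularMap S punctured ψ) (y : Y) (v w : s.fiber y) :
    ψ (s.map ⟨y, v⟩) = ψ (s.map ⟨y, w⟩) := by
  obtain ⟨U, hU, hy, k, e, e', hee', he, he'⟩ := s.locallyTrivial y
  -- The local trivialization parametrizes the fibre over `y` by affine space, where regular maps to
  -- `ℂ^×` are constant.
  have h1 : IsRegularMapOn (affine k) s.total (fun z => ⟨y, e' y z⟩) Set.univ :=
    IsRegularMapOn.comp (f := fun z => (y, z)) he' (isRegularMap_slice S _ y)
      fun z _ => ⟨hy, trivial⟩
  have h2 : IsRegularMap (affine k) punctured fun z => ψ (s.map ⟨y, e' y z⟩) :=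
    (hψ.comp s.isRegularMap_map).comp h1
  obtain ⟨c, hc⟩ := h2.exists_eq_const
  have h3 : ∀ v, e' y (e y v) = v := fun v => LinearMap.congr_fun (hee' y hy).1 v
  rw [← h3 v, ← h3 w, hc, hc]

theorem AlgebraicSpray.verticalImage_germ_eq_zero {S : SpaceWithFunctions Y} (s : AlgebraicSpray S)
    {ψ : Y → ℂˣ} (hψ : IsRegularMap S punctured ψ) {y : Y} {D : S.tangentSpace y}
    (hD : D ∈ s.verticalImage y) :
    D.1 (S.germ (Set.mem_univ y) hψ.isRegularOn_val) = 0 := by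
  obtain ⟨v, hv⟩ := hD
  refine (hv _ _ (Set.mem_univ y) hψ.isRegularOn_val).unique ?_
  simp only [fun t : ℂ => s.comp_map_eq hψ y (t • v) 0]
  exact hasDerivAt_const _ _

/-- A variety with a regular map to the punctured line that has nonzero derivative along some
holomorphic curve is not algebraically subelliptic. -/
theorem not_isAlgebraicallySubelliptic {S : SpaceWithFunctions Y} {ψ : Y → ℂˣ}
    (hψ : IsRegularMap S punctured ψ) {y : Y} {D : S.tangentSpace y}
    (hD : D.1 (S.germ (Set.mem_univ y) hψ.isRegularOn_val) ≠ 0) :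
    ¬ S.IsAlgebraicallySubelliptic := by
  rintro ⟨m, s, hs⟩
  -- The differential of `ψ` at `y`; its kernel contains every vertical image, so these cannot span.
  let ev : S.tangentSpace y →ₗ[ℂ] ℂ :=
    (LinearMap.applyₗ (S.germ (Set.mem_univ y) hψ.isRegularOn_val)).comp
      (S.tangentSpace y).subtype
  have h : Submodule.span ℂ (⋃ j, (s j).verticalImage y) ≤ LinearMap.ker ev := by
    refine Submodule.span_le.2 fun D hD => ?_
    obtain ⟨j, hj⟩ := Set.mem_iUnion.1 hD
    exact (s j).verticalImage_germ_eq_zero hψ hj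
  rw [hs y] at h
  exact hD (h (Submodule.mem_top (x := D)))

end SpaceWithFunctions

/-! ### Obstruction to approximation and null homotopic examples -/

namespace SpaceWithFunctions

variable {X : Type u} {Y : Type v}

/-- A map whose composition with a regular map to the punctured line is not constant cannot be
approximated by regular maps from affine space. -/
theorem not_approximableByRegularMaps {T : SpaceWithFunctions Y} {ψ : Y → ℂˣ}
    (hψ : IsRegularMap T punctured ψ) {n : ℕ} {K : Set (Fin n → ℂ)} {f : C(K, T.Analytic)}
    (hf : ∃ x y : K, ψ (f x) ≠ ψ (f y)) : ¬ T.ApproximableByRegularMaps f := by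
  obtain ⟨x, y, hxy⟩ := hf
  intro h
  have hcont : @Continuous T.Analytic ℂ _ _ fun z => (ψ z : ℂ) :=
    IsRegularOn.continuous hψ.isRegularOn_val
  have hclosed : IsClosed {g : C(K, T.Analytic) | (ψ (g x) : ℂ) = ψ (g y)} :=
    isClosed_eq (hcont.comp (continuous_eval_const x)) (hcont.comp (continuous_eval_const y))
  refine hxy (Units.ext (closure_minimal ?_ hclosed h))
  rintro g ⟨p, hp, hgp⟩
  obtain ⟨c, hc⟩ := (hψ.comp hp).exists_eq_const
  have : ∀ z : K, ψ (g z) = c := fun z => (congrArg ψ (hgp z)).trans (hc z)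
  change (ψ (g x) : ℂ) = ψ (g y)
  rw [this, this]

/-- Compact convex sets with at least two points carry null homotopic holomorphic maps that are not
constant after composition with `ψ`, if `ψ` has a local holomorphic section. -/
theorem exists_isHolomorphic_nullhomotopic {T : SpaceWithFunctions Y} {ψ : Y → ℂˣ} {T₀ : ℂ}
    {γ : ℂ → T.Analytic} (hγ : ∀ᶠ t in 𝓝 T₀,
      (∀ (g : Y → ℂ) (U : Set Y), T.IsRegularOn g U → γ t ∈ U →
        DifferentiableAt ℂ (fun s => g (γ s)) t) ∧ ContinuousAt γ t ∧ (ψ (γ t) : ℂ) = t)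
    {n : ℕ} {K : Set (Fin n → ℂ)} (hK : IsCompact K) (hconv : Convex ℝ K) (hnt : K.Nontrivial) :
    ∃ f : C(K, T.Analytic), T.IsHolomorphic f ∧ f.Nullhomotopic ∧
      ∃ x y : K, ψ (f x) ≠ ψ (f y) := by
  obtain ⟨x, hx, y, hy, hxy⟩ := hnt
  obtain ⟨i, hi⟩ := Function.ne_iff.1 hxy
  obtain ⟨r, hr, hball⟩ := Metric.eventually_nhds_iff_ball.1 hγ
  obtain ⟨R, hR, hKR⟩ := hK.isBounded.exists_pos_norm_le
  -- The scale at which the affine function `l` maps `K`, of norm at most `R`, into the open ball of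
  -- radius `r` about `T₀`; the `+ 1` makes the inequality strict. The coordinate `i` separates `x`
  -- and `y`, hence so does `l`.
  let ε : ℝ := r / (R + 1)
  have hε : 0 < ε := by positivity
  let l : (Fin n → ℂ) → ℂ := fun z => T₀ + ε * z i
  have hl : Differentiable ℂ l := by fun_prop
  have hlK : ∀ z ∈ K, l z ∈ Metric.ball T₀ r := by
    intro z hz
    rw [mem_ball_iff_norm, add_sub_cancel_left, norm_mul, Complex.norm_real, Real.norm_of_nonneg
      hε.le]
    calc ε * ‖z i‖ ≤ ε * R := by gcongr; exact (norm_le_pi_norm z i).trans (hKR z hz)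
      _ < ε * (R + 1) := by gcongr; linarith
      _ = r := div_mul_cancel₀ _ (by positivity)
  have hcont : ∀ z, l z ∈ Metric.ball T₀ r → ContinuousAt (fun z => γ (l z)) z := fun z hz =>
    ContinuousAt.comp (hball _ hz).2.1 hl.continuous.continuousAt
  let f : C(K, T.Analytic) := ⟨fun z => γ (l z), continuous_iff_continuousAt.2 fun z =>
    ContinuousAt.comp (g := fun z => γ (l z)) (hcont z (hlK z z.2))
      continuous_subtype_val.continuousAt⟩
  refine ⟨f, ⟨l ⁻¹' Metric.ball T₀ r, fun z => γ (l z), hlK,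
    ⟨Metric.isOpen_ball.preimage hl.continuous, fun z hz => (hcont z hz).continuousWithinAt,
      fun g V hg z hz => ?_⟩, fun z => rfl⟩, ?_, ⟨x, hx⟩, ⟨y, hy⟩, fun h => ?_⟩
  · exact (DifferentiableAt.comp z (g := fun s => g (γ s)) ((hball _ hz.1).1 g V hg hz.2)
      (hl z)).differentiableWithinAt
  · have : ContractibleSpace K := hconv.contractibleSpace ⟨x, hx⟩
    exact (id_nullhomotopic K).comp_right f
  · have h' := congrArg (fun z : ℂˣ => (z : ℂ)) h
    have h'' : l x = l y :=
      (hball _ (hlK x hx)).2.2.symm.trans (h'.trans (hball _ (hlK y hy)).2.2)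
    have hε' : (ε : ℂ) ≠ 0 := by exact_mod_cast hε.ne'
    exact hi (mul_left_cancel₀ hε' (add_left_cancel h''))

end SpaceWithFunctions

/-! ### The main theorem -/

open SpaceWithFunctions in
theorem mainTheorem8 {G : Type u} [Group G] (S : SpaceWithFunctions G)
    (hG : IsLinearAlgebraicGroup S)
    (H : Subgroup G) (hH : IsClosed[S.zariski] (H : Set G))
    (χ : G →* ℂˣ) (hχreg : IsRegularMap S punctured χ) (hχ : χ ≠ 1)
    (hχH : ∀ h ∈ H, χ h = 1) :
    -- regular maps from affine space to the punctured line are constant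
    (∀ (n : ℕ) (p : (Fin n → ℂ) → ℂˣ), IsRegularMap (affine n) punctured p →
      ∃ c : ℂˣ, ∀ x, p x = c) ∧
    IsRegularMap (S.homogeneous H) punctured (characterDescent H χ hχH) ∧
    -- the obstruction to approximation
    (∀ (n : ℕ) (K : Set (Fin n → ℂ)), IsCompact K → Convex ℝ K →
      ∀ f : C(K, (S.homogeneous H).Analytic), (S.homogeneous H).IsHolomorphic f →
        (∃ x y : K, characterDescent H χ hχH (f x) ≠ characterDescent H χ hχH (f y)) →
        ¬ (S.homogeneous H).ApproximableByRegularMaps f) ∧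
    (ConnectedSpace S.Analytic → Function.Surjective (characterDescent H χ hχH)) ∧
    (Function.Surjective (characterDescent H χ hχH) →
      -- such maps exist, and they are null homotopic
      (∀ (n : ℕ) (K : Set (Fin n → ℂ)), IsCompact K → Convex ℝ K → K.Nontrivial →
        ∃ f : C(K, (S.homogeneous H).Analytic), (S.homogeneous H).IsHolomorphic f ∧
          f.Nullhomotopic ∧
          (∃ x y : K, characterDescent H χ hχH (f x) ≠ characterDescent H χ hχH (f y)) ∧
          ¬ (S.homogeneous H).ApproximableByRegularMaps f) ∧
      ¬ (S.homogeneous H).IsAlgebraicallySubelliptic) := by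
  have hφ : IsRegularMap (S.homogeneous H) punctured (characterDescent H χ hχH) :=
    isRegularMap_of_comp_quotient hχreg
  refine ⟨fun n p hp => hp.exists_eq_const, hφ,
    fun n K _ _ f _ hf => not_approximableByRegularMaps hφ hf, fun hconn => ?_, fun hsurj => ?_⟩
  · have hpre : IsPreconnected (Set.range fun a : S.Analytic => (χ a : ℂ)) :=
      isPreconnected_range (IsRegularOn.continuous hχreg.isRegularOn_val)
    obtain ⟨a, ha⟩ : ∃ a, χ a ≠ 1 := by
      by_contra! h
      exact hχ (MonoidHom.ext h)
    -- A preconnected subset of `ℂ` with two points is infinite; here the points are `χ a` and `1`.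
    have hinf := hpre.infinite_of_nontrivial ⟨_, ⟨a, rfl⟩, _, ⟨(1 : G), rfl⟩, fun h =>
      ha ((Units.ext h).trans (map_one χ))⟩
    have hinf' : (Set.range χ).Infinite := by
      refine Set.Infinite.of_image (fun z : ℂˣ => (z : ℂ)) ?_
      rwa [← Set.range_comp]
    intro z
    obtain ⟨a, rfl⟩ := hG.surjective_of_infinite_range hχreg hinf' z
    exact ⟨(a : G ⧸ H), rfl⟩
  · have hχsurj : Function.Surjective χ := by
      intro z
      obtain ⟨⟨a⟩, ha⟩ := hsurj z
      exact ⟨a, ha⟩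
    have hinf : (Set.range χ).Infinite := by
      rw [hχsurj.range_eq]
      have : Infinite ℂˣ := Infinite.of_injective
        (fun n : ℕ => Units.mk0 ((n : ℂ) + 1) (Nat.cast_add_one_ne_zero n)) fun a b hab => by
          simpa using congrArg (fun z : ℂˣ => (z : ℂ)) hab
      exact Set.infinite_univ
    obtain ⟨T₀, γ, hγ⟩ := hG.exists_section hχreg hinf
    have hπ := (isRegularMap_quotient S fun a : G => (a : G ⧸ H)).continuous
    let c : ℂ → (S.homogeneous H).Analytic := fun t => (γ t : G ⧸ H)
    have hc : ∀ᶠ t in 𝓝 T₀, (∀ (g : G ⧸ H → ℂ) (U : Set (G ⧸ H)),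
        (S.homogeneous H).IsRegularOn g U → c t ∈ U → DifferentiableAt ℂ (fun s => g (c s)) t) ∧
        ContinuousAt c t ∧ (characterDescent H χ hχH (c t) : ℂ) = t :=
      hγ.mono fun t ht => ⟨fun g U hg hU => ht.1 _ _ hg hU,
        ContinuousAt.comp (Y := S.Analytic) hπ.continuousAt ht.2.1, ht.2.2⟩
    refine ⟨fun n K hK hconv hnt => ?_, ?_⟩
    · obtain ⟨f, h1, h2, h3⟩ := exists_isHolomorphic_nullhomotopic hc hK hconv hnt
      exact ⟨f, h1, h2, h3, not_approximableByRegularMaps hφ h3⟩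
    · obtain ⟨h1, h2, -⟩ := hc.self_of_nhds
      have hzar : Filter.Tendsto c (𝓝 T₀) (@nhds _ (S.homogeneous H).zariski (c T₀)) := by
        intro V hV
        obtain ⟨U, hUV, hU, hcU⟩ := (@mem_nhds_iff (G ⧸ H) (S.homogeneous H).zariski (c T₀) V).1 hV
        exact Filter.mem_of_superset
          (h2.preimage_mem_nhds ((isOpen_analytic hU).mem_nhds hcU)) (Set.preimage_mono hUV)
      obtain ⟨D, hD⟩ := exists_tangent_of_curve (S.homogeneous H) c T₀ hzar h1
      refine not_isAlgebraicallySubelliptic hφ (D := D) ?_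
      rw [hD]
      -- As `φ (c t) = t` near `T₀`, the tangent vector of `c` has derivative `1` on `φ`.
      have : (fun s => (characterDescent H χ hχH (c s) : ℂ)) =ᶠ[𝓝 T₀] id :=
        hc.mono fun t ht => ht.2.2
      rw [this.deriv_eq, deriv_id]
      exact one_ne_zero
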